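/- Let $u=u(x,y)$ range over the complex-valued Schwartz functions on $\mathbb{R}^2$, let $\mathcal{C}$ be complex conjugation, and let $D_x^{-1}$ be the skew-adjoint inverse of $D_x=\partial/\partial x$, $$D_x^{-1}w(x,y)=\tfrac12\Big(\int_{-\infty}^x w(s,y)\,ds-\int_x^{\infty} w(s,y)\,ds\Big).$$ Put $$\mathcal{H}=D_x-iu\,D_x^{-1}\mathrm{Im}(u\,\mathcal{C}),\qquad \mathcal{I}=-i,\qquad \mathcal{R}=i\big(D_x+u\,D_x^{-1}\mathrm{Re}(u\,\mathcal{C})\big).$$ For a real functional $\mathfrak{F}$ of $u$, the variational derivative $\delta\mathfrak{F}/\delta\bar u$ is the Schwartz function with $\frac{d}{d\epsilon}\mathfrak{F}(u+\epsilon\varphi)|_{\epsilon=0}=2\iint\mathrm{Re}\big((\delta\mathfrak{F}/\delta\bar u)\,\bar\varphi\big)\,dx\,dy$ for all Schwartz $\varphi$. An operator $\mathcal{D}$ (depending on $u$) is Hamiltonian if, on twice continuously differentiable real functionals with Schwartz-valued variational derivatives, the bracket $\{\mathfrak{F},\mathfrak{G}\}=\iint\mathrm{Re}\big(\mathcal{D}(\delta\mathfrak{F}/\delta\bar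 u)\,\delta\mathfrak{G}/\delta u\big)\,dx\,dy$, where $\delta\mathfrak{G}/\delta u=\overline{\delta\mathfrak{G}/\delta\bar u}$, is skew-symmetric, has a variational derivative, and satisfies the Jacobi identity. **Theorem.** (a) $\mathcal{H}$ and $\mathcal{I}$ are compatible Hamiltonian operators, i.e. every real linear combination of them is Hamiltonian; $\mathcal{I}$ is invertible and $\mathcal{R}=\mathcal{H}\mathcal{I}^{-1}$. (b) For $n=0,1,2,\dots$ let $$H^{(n)}=\frac{2}{1+n}\,D_x^{-1}\mathrm{Re}\big(\bar u\,\mathcal{R}^{n+1}(u_y)\big),\qquad \mathfrak{F}^{(n)}=\iint H^{(n)}\,dx\,dy ,$$ where the integral is taken first over $y$ and then over $x$ (i.e. $H^{(n)}$ is taken modulo total derivatives). These integrals converge, and $\mathfrak{F}^{(n)}$ is a twice continuously differentiable functional with a variational derivative; for $n=0$, $\mathcal{I}(\delta\mathfrak{F}^{(0)}/\delta\bar u)=u_y$. (c) The recursion operator $\mathcal{R}$, applied starting from $u_y$, generates a hierarchy of integrable bi-Hamiltonian $2+1$ flows, the $+n$ flows $$u_t=\mathcal{R}^n(u_y)=\mathcal{H}\big(\delta\mathfrak{F}^{(n-1)}/\delta\bar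 u\big)=\mathcal{I}\big(\delta\mathfrak{F}^{(n)}/\delta\bar u\big),\qquad n=1,2,\dots .$$ Integrability means here that the Hamiltonians $\mathfrak{F}^{(n)}$, $n\ge 0$, are in involution with respect to the brackets of both $\mathcal{H}$ and $\mathcal{I}$, and that all vector fields $\mathcal{R}^n(u_y)$, $n\ge0$, commute. (d) The $+1$ flow is the $2+1$ nonlocal NLS equation $$-iu_t=u_{xy}+\nu_0u,\qquad \nu_0=D_x^{-1}(|u|\,|u|_y),$$ and the $+2$ flow is the $2+1$ nonlocal mKdV equation $$-u_t=u_{xxy}+|u|^2u_y+\nu_0u_x+i\nu_1u,\qquad \nu_1=D_x^{-1}\mathrm{Im}(\bar u_y u_x),$$ where $\nu_{0x}=|u|\,|u|_y$ and $\nu_{1x}=\mathrm{Im}(\bar u_yu_x)$. -/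

import Mathlib

open MeasureTheory Set
open scoped SchwartzMap ContDiff ComplexConjugate

namespace SurfaceFlow

/-! ### The nonlocal operator `D_x⁻¹` -/

theorem schwartz_ray_bound {F : Type} [NormedAddCommGroup F] [NormedSpace ℝ F]
    (w : 𝓢(ℝ × ℝ, F)) :
    ∃ C : ℝ, 0 ≤ C ∧ ∀ (p : ℝ × ℝ) (s : ℝ),
      ‖w (p + (s, 0))‖ ≤ C * (1 + ‖p‖) ^ 2 * (1 + s ^ 2)⁻¹ := by
  obtain ⟨C0, h0p, h0⟩ := w.decay 0 0
  obtain ⟨C2, h2p, h2⟩ := w.decay 2 0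
  refine ⟨2 * C0 + 2 * C2, by positivity, fun p s => ?_⟩
  set q : ℝ × ℝ := p + (s, 0) with hq
  have h0' := h0 q
  have h2' := h2 q
  rw [norm_iteratedFDeriv_zero] at h0' h2'
  have hs : |s| ≤ ‖q‖ + ‖p‖ := by
    have h1 : ((s, 0) : ℝ × ℝ) = q - p := by rw [hq]; abel
    have h3 : |s| ≤ ‖((s, 0) : ℝ × ℝ)‖ := by
      simp [Prod.norm_def]
    rw [h1] at h3
    exact h3.trans (norm_sub_le _ _)
  have hs2 : s ^ 2 ≤ 2 * ‖q‖ ^ 2 + 2 * ‖p‖ ^ 2 := by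
    have := abs_nonneg s
    have h4 := sq_abs s
    nlinarith [sq_nonneg (‖q‖ - ‖p‖), norm_nonneg q, norm_nonneg p]
  rw [← div_eq_mul_inv, le_div_iff₀ (by positivity)]
  have hw := norm_nonneg (w q)
  have hp := norm_nonneg p
  simp only [pow_zero, one_mul] at h0'
  have e1 : ‖w q‖ * (1 + s ^ 2) ≤ ‖w q‖ * (1 + 2 * ‖p‖ ^ 2) + 2 * (‖q‖ ^ 2 * ‖w q‖) := by
    nlinarith
  have e2 : ‖w q‖ * (1 + 2 * ‖p‖ ^ 2) ≤ C0 * (1 + 2 * ‖p‖ ^ 2) := by gcongr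
  have e3 : (1 : ℝ) ≤ (1 + ‖p‖) ^ 2 := by nlinarith
  have e4 : 1 + 2 * ‖p‖ ^ 2 ≤ 2 * (1 + ‖p‖) ^ 2 := by nlinarith
  nlinarith [mul_le_mul_of_nonneg_left e4 h0p.le, mul_le_mul_of_nonneg_left e3 h2p.le]

theorem schwartz_ray_integrable {F : Type} [NormedAddCommGroup F] [NormedSpace ℝ F]
    (w : 𝓢(ℝ × ℝ, F)) (p : ℝ × ℝ) : Integrable (fun s : ℝ => w (p + (s, 0))) := by
  obtain ⟨C, -, hC⟩ := schwartz_ray_bound w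
  refine (integrable_inv_one_add_sq.const_mul (C * (1 + ‖p‖) ^ 2)).mono' ?_ ?_
  · exact (w.continuous.comp (by fun_prop)).aestronglyMeasurable
  · exact Filter.Eventually.of_forall fun s => hC p s

theorem schwartz_ray_growth (S : Set ℝ) (n : ℕ) :
    ∀ {F : Type} [NormedAddCommGroup F] [NormedSpace ℝ F] (w : 𝓢(ℝ × ℝ, F)),
      ContDiff ℝ n (fun p : ℝ × ℝ => ∫ s in S, w (p + (s, 0))) ∧
      ∃ (k : ℕ) (C : ℝ), ∀ p : ℝ × ℝ,
        ‖iteratedFDeriv ℝ n (fun p : ℝ × ℝ => ∫ s in S, w (p + (s, 0))) p‖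
          ≤ C * (1 + ‖p‖) ^ k := by
  have hd : ∀ {F : Type} [NormedAddCommGroup F] [NormedSpace ℝ F] (w : 𝓢(ℝ × ℝ, F))
      (p : ℝ × ℝ), HasFDerivAt (fun p : ℝ × ℝ => ∫ s in S, w (p + (s, 0)))
        (∫ s in S, SchwartzMap.fderivCLM ℝ (ℝ × ℝ) F w (p + (s, 0))) p := by
    intro F _ _ w p
    obtain ⟨C, hC0, hC⟩ := schwartz_ray_bound (SchwartzMap.fderivCLM ℝ (ℝ × ℝ) F w)
    refine hasFDerivAt_integral_of_dominated_of_fderiv_le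
      (F' := fun q s => SchwartzMap.fderivCLM ℝ (ℝ × ℝ) F w (q + (s, 0)))
      (bound := fun s => C * (2 + ‖p‖) ^ 2 * (1 + s ^ 2)⁻¹)
      (Metric.ball_mem_nhds p one_pos) ?_ ?_ ?_ ?_ ?_ ?_
    · exact Filter.Eventually.of_forall fun q =>
        (schwartz_ray_integrable w q).aestronglyMeasurable.restrict
    · exact (schwartz_ray_integrable w p).restrict
    · exact (schwartz_ray_integrable _ p).aestronglyMeasurable.restrict
    · refine Filter.Eventually.of_forall fun s q hq => (hC q s).trans ?_
      have : ‖q‖ ≤ 1 + ‖p‖ := by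
        have h1 : ‖q - p‖ < 1 := by simpa [dist_eq_norm] using hq
        have h2 := norm_le_norm_add_norm_sub p q
        rw [norm_sub_rev] at h2
        linarith
      have h3 : 1 + ‖q‖ ≤ 2 + ‖p‖ := by linarith
      gcongr
    · exact (integrable_inv_one_add_sq.const_mul _).restrict
    · refine Filter.Eventually.of_forall fun s q _ => ?_
      exact (hasFDerivAt_comp_add_right (s, 0)).2 (w.hasFDerivAt (q + (s, 0)))
  induction n with
  | zero =>
    intro F _ _ w
    refine ⟨?_, ?_⟩
    · simpa using continuous_iff_continuousAt.2 fun p => (hd w p).continuousAt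
    · obtain ⟨C, hC0, hC⟩ := schwartz_ray_bound w
      refine ⟨2, C * ∫ s in S, (1 + s ^ 2)⁻¹, fun p => ?_⟩
      rw [norm_iteratedFDeriv_zero]
      calc _ ≤ ∫ s in S, C * (1 + ‖p‖) ^ 2 * (1 + s ^ 2)⁻¹ := by
            refine norm_integral_le_of_norm_le (integrable_inv_one_add_sq.const_mul _).restrict ?_
            exact Filter.Eventually.of_forall fun s => hC p s
        _ = _ := by rw [integral_const_mul]; ring
  | succ n ih =>
    intro F _ _ w
    have hf : fderiv ℝ (fun p : ℝ × ℝ => ∫ s in S, w (p + (s, 0))) =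
        fun p => ∫ s in S, SchwartzMap.fderivCLM ℝ (ℝ × ℝ) F w (p + (s, 0)) :=
      funext fun p => (hd w p).fderiv
    obtain ⟨h1, k, C, h2⟩ := ih (SchwartzMap.fderivCLM ℝ (ℝ × ℝ) F w)
    refine ⟨?_, k, C, fun p => ?_⟩
    · push_cast
      rw [contDiff_succ_iff_fderiv]
      refine ⟨fun p => (hd w p).differentiableAt, by simp, ?_⟩
      rw [hf]; exact h1
    · rw [← norm_iteratedFDeriv_fderiv, hf]
      exact h2 p

/-- `D_x⁻¹ w`, the inverse of `∂/∂x` that is skew-adjoint for the `L²` pairing: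
`(D_x⁻¹ w)(x, y) = ½ (∫_{-∞}^x w(s, y) ds - ∫_x^∞ w(s, y) ds)`. -/
noncomputable def DxInv (w : ℝ × ℝ → ℝ) (p : ℝ × ℝ) : ℝ :=
  ((∫ s in Iic p.1, w (s, p.2)) - ∫ s in Ioi p.1, w (s, p.2)) / 2

theorem DxInv_hasTemperateGrowth (w : 𝓢(ℝ × ℝ, ℝ)) : (DxInv w).HasTemperateGrowth := by
  have key : ∀ S : Set ℝ, Function.HasTemperateGrowth
      (fun p : ℝ × ℝ => ∫ s in S, w (p + (s, 0))) := fun S =>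
    ⟨contDiff_infty.2 fun n => (schwartz_ray_growth S n w).1,
      fun n => (schwartz_ray_growth S n w).2⟩
  have e : DxInv w = (fun p : ℝ × ℝ => ((∫ s in Iic (0 : ℝ), w (p + (s, 0))) -
      ∫ s in Ioi (0 : ℝ), w (p + (s, 0))) * (1 / 2)) := by
    funext p
    obtain ⟨x, y⟩ := p
    have m := measurePreserving_add_left (volume : Measure ℝ) x
    have em := measurableEmbedding_addLeft x
    have h1 := m.setIntegral_preimage_emb em (fun s => w (s, y)) (Iic x)
    have h2 := m.setIntegral_preimage_emb em (fun s => w (s, y)) (Ioi x)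
    have s1 : (fun s => x + s) ⁻¹' Iic x = Iic 0 := by ext; simp
    have s2 : (fun s => x + s) ⁻¹' Ioi x = Ioi 0 := by ext; simp
    rw [s1] at h1
    rw [s2] at h2
    simp only [DxInv, Prod.mk_add_mk, add_zero]
    rw [h1, h2]; ring
  rw [e]
  exact ((key _).sub (key _)).mul (.const _)

/-! ### Field variables and differential operators

The field variable `u(x, y)` and all variations of it are complex-valued Schwartz functions on
the `(x, y)` plane. -/

/-- Complex-valued Schwartz functions of `(x, y)`. -/
abbrev FieldVar : Type := 𝓢(ℝ × ℝ, ℂ)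

/-- `D_x = ∂/∂x`. -/
noncomputable def Dx (f : FieldVar) : FieldVar := LineDeriv.lineDerivOp ((1, 0) : ℝ × ℝ) f

/-- `D_y = ∂/∂y`. -/
noncomputable def Dy (f : FieldVar) : FieldVar := LineDeriv.lineDerivOp ((0, 1) : ℝ × ℝ) f

/-- `u f̄`, i.e. `u 𝒞 f` with `𝒞` the complex conjugation operator. -/
noncomputable def mulConj (u f : FieldVar) : FieldVar :=
  SchwartzMap.pairing (ContinuousLinearMap.mul ℝ ℂ) u
    (f.postcompCLM (𝕜 := ℝ) (Complex.conjCLE : ℂ →L[ℝ] ℂ))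

theorem mulConj_apply (u f : FieldVar) (p : ℝ × ℝ) : mulConj u f p = u p * conj (f p) := rfl

/-- `Re (u 𝒞 f)`. -/
noncomputable def reMul (u f : FieldVar) : 𝓢(ℝ × ℝ, ℝ) :=
  (mulConj u f).postcompCLM (𝕜 := ℝ) Complex.reCLM

/-- `Im (u 𝒞 f)`. -/
noncomputable def imMul (u f : FieldVar) : 𝓢(ℝ × ℝ, ℝ) :=
  (mulConj u f).postcompCLM (𝕜 := ℝ) Complex.imCLM

theorem reMul_apply (u f : FieldVar) (p : ℝ × ℝ) : reMul u f p = (u p * conj (f p)).re := rfl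

theorem imMul_apply (u f : FieldVar) (p : ℝ × ℝ) : imMul u f p = (u p * conj (f p)).im := rfl

/-- `u D_x⁻¹ w`, which is again a Schwartz function. -/
noncomputable def mulDxInv (u : FieldVar) (w : 𝓢(ℝ × ℝ, ℝ)) : FieldVar :=
  SchwartzMap.smulLeftCLM ℂ (DxInv w) u

theorem mulDxInv_apply (u : FieldVar) (w : 𝓢(ℝ × ℝ, ℝ)) (p : ℝ × ℝ) :
    mulDxInv u w p = u p * DxInv w p := by
  rw [mulDxInv, SchwartzMap.smulLeftCLM_apply_apply (DxInv_hasTemperateGrowth w),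
    Complex.real_smul, mul_comm]

/-- `ℋ = D_x - i u D_x⁻¹ Im(u 𝒞)`. -/
noncomputable def opH (u f : FieldVar) : FieldVar := Dx f - Complex.I • mulDxInv u (imMul u f)

/-- `ℐ = -i`. -/
noncomputable def opI (_u f : FieldVar) : FieldVar := (-Complex.I) • f

/-- `ℛ = i (D_x + u D_x⁻¹ Re(u 𝒞))`. -/
noncomputable def opR (u f : FieldVar) : FieldVar := Complex.I • (Dx f + mulDxInv u (reMul u f))

/-- The vector field `ℛⁿ(u_y)`. -/
noncomputable def flow (n : ℕ) (u : FieldVar) : FieldVar := (opR u)^[n] (Dy u)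

/-! ### Functionals, variational derivatives, Hamiltonian operators -/

/-- `g = δF/δū`: at every `u`, the derivative of `F` in the direction of the variation `φ = δu` is
`∬ (g δū + ḡ δu) dx dy = 2 ∬ Re (g φ̄) dx dy`. -/
def IsVarDeriv (F : FieldVar → ℝ) (g : FieldVar → FieldVar) : Prop :=
  ∀ u φ : FieldVar,
    HasDerivAt (fun ε : ℝ => F (u + ε • φ)) (∫ p, 2 * (g u p * conj (φ p)).re) 0

/-- `F` is a twice continuously differentiable real functional with variational derivative
`g = δF/δū`; the map `g` is required to be differentiable along lines (in the topology of the
Schwartz space), with derivatives that are continuous on affine planes. -/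
def IsFunctional (F : FieldVar → ℝ) (g : FieldVar → FieldVar) : Prop :=
  IsVarDeriv F g ∧ ∃ Dg : FieldVar → FieldVar → FieldVar,
    (∀ u φ : FieldVar, HasDerivAt (fun ε : ℝ => g (u + ε • φ)) (Dg u φ) 0) ∧
    (∀ u φ ψ : FieldVar, Continuous fun s : ℝ × ℝ => Dg (u + s.1 • φ + s.2 • ψ) φ)

/-- The bracket `{F, G} = ∬ Re (𝒟(δF/δū) δG/δu) dx dy`, in terms of `f = δF/δū` and `g = δG/δū`
(so that `δG/δu = ḡ`). -/
noncomputable def bracket (𝒟 : FieldVar → FieldVar → FieldVar) (f g : FieldVar → FieldVar) (u : FieldVar) : ℝ :=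
  ∫ p, (𝒟 u (f u) p * conj (g u p)).re

/-- `𝒟` is a Hamiltonian operator: its bracket is skew-symmetric, brackets have variational
derivatives, and the Jacobi identity `{F, {G, K}} + {G, {K, F}} + {K, {F, G}} = 0` holds. -/
def IsHamiltonianOperator (𝒟 : FieldVar → FieldVar → FieldVar) : Prop :=
  ∀ (F G K : FieldVar → ℝ) (f g k : FieldVar → FieldVar),
    IsFunctional F f → IsFunctional G g → IsFunctional K k →
    (∀ u, bracket 𝒟 f g u = -bracket 𝒟 g f u) ∧
    ∃ a b c : FieldVar → FieldVar,
      IsVarDeriv (bracket 𝒟 g k) a ∧ IsVarDeriv (bracket 𝒟 k f) b ∧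
      IsVarDeriv (bracket 𝒟 f g) c ∧
      ∀ u, bracket 𝒟 f a u + bracket 𝒟 g b u + bracket 𝒟 k c u = 0

/-- A compatible pair of Hamiltonian operators: all real linear combinations (in particular both
operators themselves) are Hamiltonian operators. -/
def IsCompatibleHamiltonianPair (𝒟₁ 𝒟₂ : FieldVar → FieldVar → FieldVar) : Prop :=
  ∀ a b : ℝ, IsHamiltonianOperator fun u f => a • 𝒟₁ u f + b • 𝒟₂ u f

/-! ### The Hamiltonians and the flows -/

/-- The density `H⁽ⁿ⁾ = 2/(1+n) D_x⁻¹ Re(ū ℛⁿ⁺¹(u_y))`. -/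
noncomputable def density (n : ℕ) (u : FieldVar) (p : ℝ × ℝ) : ℝ :=
  2 / (1 + (n : ℝ)) * DxInv (fun q => (conj (u q) * flow (n + 1) u q).re) p

/-- `𝔉⁽ⁿ⁾ = ∬ H⁽ⁿ⁾ dx dy`. The integral is an iterated one, first over `y`, since `D_x⁻¹` produces
a function that decays as `x → ±∞` only up to a total `y`-derivative. -/
noncomputable def hamiltonian (n : ℕ) (u : FieldVar) : ℝ :=
  ∫ x : ℝ, ∫ y : ℝ, density n u (x, y)

/-- `U(t)` satisfies the evolution equation `U_t = X(U)` at all times `t ∈ J`. -/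
def Solves (X : FieldVar → FieldVar) (J : Set ℝ) (U : ℝ → FieldVar) : Prop :=
  ∀ t ∈ J, ∀ p : ℝ × ℝ, HasDerivAt (fun τ => U τ p) (X (U t) p) t

/-- `|u| |u|_y` (at a zero of `u` the product is `0`). -/
noncomputable def absMulAbsY (u : FieldVar) (p : ℝ × ℝ) : ℝ :=
  ‖u p‖ * deriv (fun y => ‖u (p.1, y)‖) p.2

/-- `ν₀ = D_x⁻¹ (|u| |u|_y)`. -/
noncomputable def nu0 (u : FieldVar) : ℝ × ℝ → ℝ := DxInv (absMulAbsY u)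

/-- `ν₁ = D_x⁻¹ Im(ū_y u_x)`. -/
noncomputable def nu1 (u : FieldVar) : ℝ × ℝ → ℝ :=
  DxInv fun q => (conj (Dy u q) * Dx u q).im

end SurfaceFlow

open SurfaceFlow

namespace SurfaceFlow

open scoped LineDeriv

/-! ### Analytic properties of `D_x⁻¹` -/

/-! The argument is symplectic geometry on the Schwartz space. Let `omega f g = pair f (i g)`, where
`pair` is the real L² pairing. Since D_x and D_x⁻¹ are skew-adjoint, ℛ is symmetric for `omega`
(`omega_opR`). Two identities carry the rest: the two-form `omega (ℛ ·) ·` is closed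
(`omega_opR'_cyclic`), and ℛ has vanishing Nijenhuis torsion (`opR_hereditary`).

Hamiltonian pair: aℋ + bℐ = (aℛ + b)ℐ, so brackets are values of `omega (pencil ·) ·` on ℐδF, ℐδG.
In the Jacobi sum the second variations cancel because they are symmetric (`second_variation_symm`).
What remains is a² times a cyclic sum that vanishes by closedness and zero torsion
(`omega_opR'_opR_cyclic`), plus ab times the closedness identity.

Flows: translations commute with ℛ, so the Lie derivative of ℛ along u_y is zero. Zero torsion
propagates this to every ℛⁿ(u_y) (`opR'_flow`), which makes the flows commute (`dflow_flow_comm`)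
and, with closedness, makes their linearizations infinitesimally symplectic (`omega_dflow`).

Hamiltonians: ℛ has weight one under u ↦ λu(λx, y), whose generator is `dilation`. The homotopy
formula along this scaling shows that -2/(1+n) `omega (flow n u) (dilation u)` has variational
derivative iℛⁿ(u_y). It equals the iterated integral of the density because, for w of zero mean,
D_x⁻¹w integrates to minus the first x-moment of w (`integral_integral_DxInv`).

Derivatives live in the non-normable Schwartz space. For the explicit flows they come from algebraic
expansions (`HasExpansion`). For arbitrary functionals only pairings are differentiated, and it
suffices that the nonlocal operators are continuous into L². -/

theorem measurable_realSign : Measurable Real.sign := by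
  unfold Real.sign
  exact Measurable.ite measurableSet_Iio measurable_const
    (Measurable.ite measurableSet_Ioi measurable_const measurable_const)

theorem abs_realSign_le_one (r : ℝ) : |Real.sign r| ≤ 1 := by
  rcases Real.sign_apply_eq r with h | h | h <;> simp [h]

theorem integrable_horizontal_section (w : 𝓢(ℝ × ℝ, ℝ)) (y : ℝ) :
    Integrable fun s : ℝ => w (s, y) := by
  simpa using schwartz_ray_integrable w (0, y)

theorem integrable_sign_mul {α : Type*} [MeasurableSpace α] {μ : Measure α} {f : α → ℝ}
    (hf : Integrable f μ) {k : α → ℝ} (hk : Measurable k) :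
    Integrable (fun a => Real.sign (k a) / 2 * f a) μ := by
  refine hf.bdd_mul (c := 1) ?_ (Filter.Eventually.of_forall fun a => ?_)
  · exact ((measurable_realSign.comp hk).div_const 2).aestronglyMeasurable
  · have := abs_realSign_le_one (k a)
    rw [Real.norm_eq_abs, abs_div, abs_two]
    linarith

/-- Writing D_x⁻¹ with the odd kernel sign(x - s)/2 makes linearity, skew-adjointness and Fubini
arguments immediate. The diagonal s = x is a null set. -/
theorem DxInv_eq_integral_sign (w : 𝓢(ℝ × ℝ, ℝ)) (p : ℝ × ℝ) :
    DxInv w p = ∫ s, Real.sign (p.1 - s) / 2 * w (s, p.2) := by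
  have hw := integrable_horizontal_section w p.2
  have hi := integrable_sign_mul hw (k := fun s => p.1 - s) (by fun_prop)
  have h1 : ∫ s in Iic p.1, Real.sign (p.1 - s) / 2 * w (s, p.2) =
      (∫ s in Iic p.1, w (s, p.2)) / 2 := by
    rw [integral_Iic_eq_integral_Iio, integral_Iic_eq_integral_Iio, ← integral_div]
    refine setIntegral_congr_fun measurableSet_Iio fun s hs => ?_
    simp only [mem_Iio] at hs
    simp only [Real.sign_of_pos (sub_pos.2 hs)]
    ring
  have h2 : ∫ s in Ioi p.1, Real.sign (p.1 - s) / 2 * w (s, p.2) =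
      -(∫ s in Ioi p.1, w (s, p.2)) / 2 := by
    rw [← integral_neg, ← integral_div]
    refine setIntegral_congr_fun measurableSet_Ioi fun s hs => ?_
    simp only [mem_Ioi] at hs
    simp only [Real.sign_of_neg (sub_neg.2 hs)]
    ring
  have h3 := integral_add_compl (s := Iic p.1) measurableSet_Iic hi
  rw [compl_Iic, h1, h2] at h3
  rw [← h3, DxInv]
  ring

/-- Here the discontinuous kernel no longer depends on the base point, so one can differentiate
under the integral sign. -/
theorem DxInv_eq_integral_translate (w : 𝓢(ℝ × ℝ, ℝ)) (p : ℝ × ℝ) :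
    DxInv w p = ∫ s, Real.sign (-s) / 2 * w (p + (s, 0)) := by
  rw [DxInv_eq_integral_sign, ← integral_add_left_eq_self _ p.1]
  refine integral_congr_ae (Filter.Eventually.of_forall fun s => ?_)
  simp only [sub_add_cancel_left, Prod.add_def, add_zero]

theorem DxInv_add (v w : 𝓢(ℝ × ℝ, ℝ)) (p : ℝ × ℝ) :
    DxInv (v + w : 𝓢(ℝ × ℝ, ℝ)) p = DxInv v p + DxInv w p := by
  simp only [DxInv_eq_integral_sign]
  rw [← integral_add (integrable_sign_mul (integrable_horizontal_section v p.2) (by fun_prop))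
    (integrable_sign_mul (integrable_horizontal_section w p.2) (by fun_prop))]
  simp only [add_apply, mul_add]

theorem DxInv_smul (c : ℝ) (w : 𝓢(ℝ × ℝ, ℝ)) (p : ℝ × ℝ) :
    DxInv (c • w : 𝓢(ℝ × ℝ, ℝ)) p = c * DxInv w p := by
  simp only [DxInv_eq_integral_sign, smul_apply, smul_eq_mul]
  rw [← integral_const_mul]
  congr 1; ext s; ring

theorem DxInv_neg (w : 𝓢(ℝ × ℝ, ℝ)) (p : ℝ × ℝ) :
    DxInv (-w : 𝓢(ℝ × ℝ, ℝ)) p = -DxInv w p := by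
  rw [← neg_one_smul ℝ w, DxInv_smul]; ring

theorem DxInv_sub (v w : 𝓢(ℝ × ℝ, ℝ)) (p : ℝ × ℝ) :
    DxInv (v - w : 𝓢(ℝ × ℝ, ℝ)) p = DxInv v p - DxInv w p := by
  rw [sub_eq_add_neg, DxInv_add, DxInv_neg, sub_eq_add_neg]

theorem schwartz_hasDerivAt_line {F : Type} [NormedAddCommGroup F] [NormedSpace ℝ F]
    (w : 𝓢(ℝ × ℝ, F)) (p v : ℝ × ℝ) (t : ℝ) :
    HasDerivAt (fun t : ℝ => w (p + t • v)) ((∂_{v} w) (p + t • v)) t := by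
  rw [SchwartzMap.lineDerivOp_apply_eq_fderiv]
  have h : HasDerivAt (fun t : ℝ => p + t • v) v t := by
    simpa using ((hasDerivAt_id t).smul_const v).const_add p
  exact (w.hasFDerivAt (p + t • v)).comp_hasDerivAt t h

/-- `D_x⁻¹` commutes with the derivative in a direction `v`. -/
theorem DxInv_hasDerivAt_line (w : 𝓢(ℝ × ℝ, ℝ)) (p v : ℝ × ℝ) :
    HasDerivAt (fun t : ℝ => DxInv w (p + t • v)) (DxInv (∂_{v} w : 𝓢(ℝ × ℝ, ℝ)) p) 0 := by
  simp only [DxInv_eq_integral_translate]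
  obtain ⟨C, hC0, hC⟩ := schwartz_ray_bound (∂_{v} w)
  have hd := hasDerivAt_integral_of_dominated_loc_of_deriv_le (μ := (volume : Measure ℝ))
    (F := fun t s => Real.sign (-s) / 2 * w (p + t • v + (s, 0)))
    (F' := fun t s => Real.sign (-s) / 2 * (∂_{v} w) (p + t • v + (s, 0)))
    (bound := fun s => C * (1 + (‖p‖ + ‖v‖)) ^ 2 * (1 + s ^ 2)⁻¹) (x₀ := (0 : ℝ))
    (Metric.ball_mem_nhds 0 one_pos) ?_ ?_ ?_ ?_ ?_ ?_
  · simpa using hd.2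
  · exact Filter.Eventually.of_forall fun t =>
      (integrable_sign_mul (schwartz_ray_integrable w _) (by fun_prop)).aestronglyMeasurable
  · exact integrable_sign_mul (schwartz_ray_integrable w _) (by fun_prop)
  · exact (integrable_sign_mul (schwartz_ray_integrable _ _) (by fun_prop)).aestronglyMeasurable
  · refine Filter.Eventually.of_forall fun s t ht => ?_
    have h1 := hC (p + t • v) s
    have h2 := abs_realSign_le_one (-s)
    have h3 : |t| ≤ 1 := by
      have : |t| < 1 := by simpa using ht
      exact this.le
    have h4 : ‖p + t • v‖ ≤ ‖p‖ + ‖v‖ := by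
      refine (norm_add_le _ _).trans ?_
      rw [norm_smul, Real.norm_eq_abs]
      nlinarith [norm_nonneg v]
    have h5 : C * (1 + ‖p + t • v‖) ^ 2 * (1 + s ^ 2)⁻¹ ≤
        C * (1 + (‖p‖ + ‖v‖)) ^ 2 * (1 + s ^ 2)⁻¹ := by gcongr
    rw [norm_mul, Real.norm_eq_abs, abs_div, abs_two]
    nlinarith [norm_nonneg ((∂_{v} w) (p + t • v + (s, 0)))]
  · exact integrable_inv_one_add_sq.const_mul _
  · refine Filter.Eventually.of_forall fun s t _ => ?_
    have h := (schwartz_hasDerivAt_line w (p + (s, 0)) v t).const_mul (Real.sign (-s) / 2)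
    simpa only [add_right_comm] using h

/-- `D_x⁻¹ D_x w = w`. -/
theorem DxInv_lineDeriv (w : 𝓢(ℝ × ℝ, ℝ)) (p : ℝ × ℝ) :
    DxInv (∂_{((1, 0) : ℝ × ℝ)} w : 𝓢(ℝ × ℝ, ℝ)) p = w p := by
  have hd : ∀ s : ℝ, HasDerivAt (fun s => w (s, p.2)) ((∂_{((1, 0) : ℝ × ℝ)} w) (s, p.2)) s := by
    intro s
    simpa using schwartz_hasDerivAt_line w (0, p.2) (1, 0) s
  have hi := integrable_horizontal_section (∂_{((1, 0) : ℝ × ℝ)} w) p.2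
  have hw := integrable_horizontal_section w p.2
  have hc : Filter.Tendsto (fun s : ℝ => w (s, p.2)) (Filter.cocompact ℝ) (nhds 0) := by
    refine w.tendsto_cocompact.comp ?_
    exact (show Topology.IsClosedEmbedding fun s : ℝ => (s, p.2) from
      Topology.IsClosedEmbedding.of_continuous_injective_isClosedMap (by fun_prop)
        (fun a b h => by simpa using h) (isClosedMap_prodMk_right p.2)).tendsto_cocompact
  have h1 := integral_Iic_of_hasDerivAt_of_tendsto (a := p.1)
    (hd p.1).continuousAt.continuousWithinAt (fun s _ => hd s) hi.integrableOn
    (hc.mono_left atBot_le_cocompact)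
  have h2 := integral_Ioi_of_hasDerivAt_of_tendsto (a := p.1)
    (hd p.1).continuousAt.continuousWithinAt (fun s _ => hd s) hi.integrableOn
    (hc.mono_left atTop_le_cocompact)
  rw [DxInv, h1, h2]
  simp

/-- `D_x D_x⁻¹ w = w`. -/
theorem DxInv_hasDerivAt_fst (w : 𝓢(ℝ × ℝ, ℝ)) (p : ℝ × ℝ) :
    HasDerivAt (fun x => DxInv w (x, p.2)) (w p) p.1 := by
  have h := DxInv_hasDerivAt_line w p (1, 0)
  rw [DxInv_lineDeriv] at h
  have h2 : HasDerivAt (fun x : ℝ => x - p.1) 1 p.1 := (hasDerivAt_id _).sub_const _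
  have h3 := HasDerivAt.scomp (g₁ := fun t : ℝ => DxInv w (p + t • ((1, 0) : ℝ × ℝ))) p.1
    (by simpa using h) h2
  simpa [Function.comp_def, Prod.add_def] using h3

/-- `D_x⁻¹` is skew-adjoint. -/
theorem integral_mul_DxInv (a b : 𝓢(ℝ × ℝ, ℝ)) :
    ∫ p, a p * DxInv b p = -∫ p, DxInv a p * b p := by
  have hint : ∀ a b : 𝓢(ℝ × ℝ, ℝ), Integrable fun p => a p * DxInv b p := fun a b => by
    have := (SchwartzMap.smulLeftCLM ℝ (DxInv b) a).integrable (μ := volume)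
    refine this.congr (Filter.Eventually.of_forall fun p => ?_)
    simp only [SchwartzMap.smulLeftCLM_apply_apply (DxInv_hasTemperateGrowth b), smul_eq_mul,
      mul_comm]
  have h2 : Integrable fun p => DxInv a p * b p := by simpa only [mul_comm] using hint b a
  rw [Measure.volume_eq_prod, integral_prod_symm _ (hint a b), integral_prod_symm _ h2,
    ← integral_neg]
  refine integral_congr_ae (Filter.Eventually.of_forall fun y => ?_)
  have ha := integrable_horizontal_section a y
  have hb := integrable_horizontal_section b y
  -- On each horizontal line the claim is Fubini together with the oddness of the sign kernel.
  have hsw := integral_integral_swap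
    (f := fun x s : ℝ => a (x, y) * (Real.sign (x - s) / 2 * b (s, y)))
    (μ := volume) (ν := volume) (by
      refine (integrable_sign_mul (ha.mul_prod hb) (k := fun z : ℝ × ℝ => z.1 - z.2)
        (by fun_prop)).congr (Filter.Eventually.of_forall fun z => ?_)
      simp only [Function.uncurry]; ring)
  simp only [DxInv_eq_integral_sign, ← integral_const_mul, ← integral_mul_const]
  rw [hsw, ← integral_neg]
  refine integral_congr_ae (Filter.Eventually.of_forall fun s => ?_)
  simp only [← integral_neg]
  refine integral_congr_ae (Filter.Eventually.of_forall fun x => ?_)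
  simp only
  rw [← neg_sub s x, Real.sign_neg]
  ring

/-! ### Iterated integrals and bounds for `D_x⁻¹` -/

/-- Subtracting sign x cuts the kernel down to the interval between 0 and s, which makes it
integrable in x with integral -s. -/
theorem sign_kernel_ae_eq (s : ℝ) :
    (fun x : ℝ => (Real.sign (x - s) - Real.sign x) / 2) =ᵐ[volume]
      fun x => (Ioc s 0).indicator 1 x - (Ioc 0 s).indicator 1 x := by
  have h0 : ∀ᵐ x : ℝ, x ≠ 0 := by simp [ae_iff, measure_singleton]
  have hs : ∀ᵐ x : ℝ, x ≠ s := by simp [ae_iff, measure_singleton]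
  filter_upwards [h0, hs] with x hx0 hxs
  simp only [indicator_apply, mem_Ioc, Pi.one_apply]
  rcases lt_or_gt_of_ne hx0 with h | h <;> rcases lt_or_gt_of_ne hxs with h' | h'
  · rw [Real.sign_of_neg (sub_neg.2 h'), Real.sign_of_neg h, if_neg, if_neg] <;> grind
  · rw [Real.sign_of_pos (sub_pos.2 h'), Real.sign_of_neg h, if_pos, if_neg] <;> grind
  · rw [Real.sign_of_neg (sub_neg.2 h'), Real.sign_of_pos h, if_neg, if_pos] <;> grind
  · rw [Real.sign_of_pos (sub_pos.2 h'), Real.sign_of_pos h, if_neg, if_neg] <;> grind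

theorem integrable_indicator_Ioc_one (a b : ℝ) :
    Integrable ((Ioc a b).indicator (1 : ℝ → ℝ)) :=
  (integrable_indicator_iff measurableSet_Ioc).2 (integrableOn_const (by simp))

theorem integrable_sign_kernel (s : ℝ) :
    Integrable fun x : ℝ => (Real.sign (x - s) - Real.sign x) / 2 :=
  ((integrable_indicator_Ioc_one s 0).sub (integrable_indicator_Ioc_one 0 s)).congr
    (sign_kernel_ae_eq s).symm

theorem integral_sign_kernel (s : ℝ) :
    ∫ x : ℝ, (Real.sign (x - s) - Real.sign x) / 2 = -s := by
  rw [integral_congr_ae (sign_kernel_ae_eq s),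
    integral_sub (integrable_indicator_Ioc_one s 0) (integrable_indicator_Ioc_one 0 s),
    integral_indicator_one measurableSet_Ioc, integral_indicator_one measurableSet_Ioc]
  simp only [Real.volume_real_Ioc, zero_sub, sub_zero]
  grind

theorem integral_abs_sign_kernel_le (s : ℝ) :
    ∫ x : ℝ, |(Real.sign (x - s) - Real.sign x) / 2| ≤ |s| := by
  have h : ∫ x : ℝ, |(Real.sign (x - s) - Real.sign x) / 2| ≤
      ∫ x : ℝ, ((Ioc s 0).indicator 1 x + (Ioc 0 s).indicator 1 x) := by
    refine integral_mono_ae (integrable_sign_kernel s).abs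
      ((integrable_indicator_Ioc_one s 0).add (integrable_indicator_Ioc_one 0 s)) ?_
    filter_upwards [sign_kernel_ae_eq s] with x hx
    rw [hx]
    have h1 : 0 ≤ (Ioc s 0).indicator (1 : ℝ → ℝ) x := indicator_nonneg (fun _ _ => zero_le_one) x
    have h2 : 0 ≤ (Ioc 0 s).indicator (1 : ℝ → ℝ) x := indicator_nonneg (fun _ _ => zero_le_one) x
    exact abs_le.2 ⟨by linarith, by linarith⟩
  refine h.trans_eq ?_
  rw [integral_add (integrable_indicator_Ioc_one s 0) (integrable_indicator_Ioc_one 0 s),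
    integral_indicator_one measurableSet_Ioc, integral_indicator_one measurableSet_Ioc]
  simp only [Real.volume_real_Ioc, zero_sub, sub_zero]
  grind

theorem integrable_DxInv_vertical (w : 𝓢(ℝ × ℝ, ℝ)) (x : ℝ) :
    Integrable fun y : ℝ => DxInv w (x, y) := by
  simp only [DxInv_eq_integral_sign]
  exact (integrable_sign_mul w.integrable (k := fun z : ℝ × ℝ => x - z.1)
    (by fun_prop)).integral_prod_right

theorem integral_DxInv_vertical (w : 𝓢(ℝ × ℝ, ℝ)) (x : ℝ) :
    ∫ y : ℝ, DxInv w (x, y) = ∫ z, Real.sign (x - z.1) / 2 * w z := by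
  simp only [DxInv_eq_integral_sign]
  rw [Measure.volume_eq_prod, integral_prod_symm]
  exact integrable_sign_mul w.integrable (k := fun z : ℝ × ℝ => x - z.1) (by fun_prop)

/-- Zero mean allows the x-dependent constant sign(x)/2 to be subtracted from the kernel at no cost.
This is the source of decay as x → ±∞. -/
theorem integral_DxInv_vertical_of_integral_eq_zero (w : 𝓢(ℝ × ℝ, ℝ)) (hw : ∫ z, w z = 0) (x : ℝ) :
    ∫ y : ℝ, DxInv w (x, y) = ∫ z, (Real.sign (x - z.1) - Real.sign x) / 2 * w z := by
  have h1 := integrable_sign_mul (w.integrable (μ := volume)) (k := fun z : ℝ × ℝ => x - z.1)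
    (by fun_prop)
  have h2 := (w.integrable (μ := volume)).const_mul (Real.sign x / 2)
  have h3 := integral_sub h1 h2
  rw [integral_const_mul, hw, mul_zero, sub_zero] at h3
  rw [integral_DxInv_vertical, ← h3]
  congr 1; ext z; ring

theorem integrable_fst_mul (w : 𝓢(ℝ × ℝ, ℝ)) : Integrable fun z : ℝ × ℝ => |z.1| * ‖w z‖ := by
  refine (w.integrable_pow_mul volume 1).mono'
    (Continuous.aestronglyMeasurable (by have := w.continuous; fun_prop))
    (Filter.Eventually.of_forall fun z => ?_)
  rw [norm_mul, norm_norm, Real.norm_eq_abs, abs_abs, pow_one]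
  exact mul_le_mul_of_nonneg_right (norm_fst_le z) (norm_nonneg _)

theorem integrable_sign_kernel_mul (w : 𝓢(ℝ × ℝ, ℝ)) :
    Integrable (fun q : (ℝ × ℝ) × ℝ => (Real.sign (q.2 - q.1.1) - Real.sign q.2) / 2 * w q.1)
      ((volume : Measure (ℝ × ℝ)).prod volume) := by
  have hm := measurable_realSign
  have hc := w.continuous.measurable
  rw [integrable_prod_iff (Measurable.aestronglyMeasurable (by fun_prop))]
  refine ⟨Filter.Eventually.of_forall fun z => by
    simpa using (integrable_sign_kernel z.1).mul_const (w z), ?_⟩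
  refine (integrable_fst_mul w).mono' (Measurable.aestronglyMeasurable ?_)
    (Filter.Eventually.of_forall fun z => ?_)
  · exact (StronglyMeasurable.integral_prod_right' (f := fun q : (ℝ × ℝ) × ℝ =>
      ‖(Real.sign (q.2 - q.1.1) - Real.sign q.2) / 2 * w q.1‖)
      (Measurable.stronglyMeasurable (by fun_prop))).measurable
  · rw [Real.norm_of_nonneg (integral_nonneg fun _ => norm_nonneg _)]
    simp only [norm_mul]
    rw [integral_mul_const]
    exact mul_le_mul_of_nonneg_right (integral_abs_sign_kernel_le z.1) (norm_nonneg _)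

theorem integrable_integral_DxInv (w : 𝓢(ℝ × ℝ, ℝ)) (hw : ∫ z, w z = 0) :
    Integrable fun x : ℝ => ∫ y : ℝ, DxInv w (x, y) := by
  simp only [integral_DxInv_vertical_of_integral_eq_zero w hw]
  exact (integrable_sign_kernel_mul w).integral_prod_right

theorem integral_integral_DxInv (w : 𝓢(ℝ × ℝ, ℝ)) (hw : ∫ z, w z = 0) :
    ∫ x : ℝ, ∫ y : ℝ, DxInv w (x, y) = -∫ z : ℝ × ℝ, z.1 * w z := by
  simp only [integral_DxInv_vertical_of_integral_eq_zero w hw]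
  rw [← integral_integral_swap (f := fun (z : ℝ × ℝ) (x : ℝ) =>
    (Real.sign (x - z.1) - Real.sign x) / 2 * w z) (integrable_sign_kernel_mul w)]
  simp only [integral_mul_const, integral_sign_kernel]
  rw [← integral_neg]
  simp only [neg_mul]

/-- `D_x⁻¹ w` is bounded by a Schwartz seminorm of `w`. -/
theorem DxInv_bound : ∃ (C : ℝ), 0 ≤ C ∧ ∀ (w : 𝓢(ℝ × ℝ, ℝ)) (p : ℝ × ℝ),
    |DxInv w p| ≤ C * (Finset.Iic (2, 0)).sup (schwartzSeminormFamily ℝ (ℝ × ℝ) ℝ) w := by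
  refine ⟨∫ s : ℝ, 4 * (1 + s ^ 2)⁻¹, integral_nonneg fun s => by positivity, fun w p => ?_⟩
  set N := (Finset.Iic (2, 0)).sup (schwartzSeminormFamily ℝ (ℝ × ℝ) ℝ) w with hN
  rw [DxInv_eq_integral_sign, ← integral_mul_const, ← Real.norm_eq_abs]
  refine norm_integral_le_of_norm_le ((integrable_inv_one_add_sq.const_mul 4).mul_const N)
    (Filter.Eventually.of_forall fun s => ?_)
  have h1 := SchwartzMap.one_add_le_sup_seminorm_apply (𝕜 := ℝ) (m := (2, 0)) (le_refl 2)
    (le_refl 0) w (s, p.2)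
  -- The constant in `h1` is 2 ^ 2, which accounts for the factor 4 in the witness.
  rw [norm_iteratedFDeriv_zero] at h1
  have h2 : 1 + s ^ 2 ≤ (1 + ‖((s, p.2) : ℝ × ℝ)‖) ^ 2 := by
    have h3 : |s| ≤ ‖((s, p.2) : ℝ × ℝ)‖ := norm_fst_le (s, p.2)
    nlinarith [abs_nonneg s, sq_abs s]
  have h4 := abs_realSign_le_one (p.1 - s)
  have h5 : (1 + s ^ 2) * ‖w (s, p.2)‖ ≤ 4 * N :=
    (mul_le_mul_of_nonneg_right h2 (norm_nonneg _)).trans (h1.trans_eq (by norm_num [hN]; rfl))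
  have h6 : ‖w (s, p.2)‖ ≤ 4 * (1 + s ^ 2)⁻¹ * N := by
    rw [mul_right_comm, ← div_eq_mul_inv, le_div_iff₀ (by positivity)]
    linarith
  rw [norm_mul, Real.norm_eq_abs, abs_div, abs_two]
  nlinarith [norm_nonneg (w (s, p.2))]

/-! ### Algebra of the building blocks -/

theorem reMul_comm (f g : FieldVar) : reMul f g = reMul g f := by
  ext p; simp only [reMul_apply, Complex.mul_re, Complex.conj_re, Complex.conj_im]; ring

theorem reMul_add_right (u f g : FieldVar) : reMul u (f + g) = reMul u f + reMul u g := by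
  ext p; simp [reMul_apply]; ring

theorem reMul_smul_right (c : ℝ) (u f : FieldVar) : reMul u (c • f) = c • reMul u f := by
  ext p; simp [reMul_apply]; ring

theorem reMul_add_left (u f g : FieldVar) : reMul (u + f) g = reMul u g + reMul f g := by
  rw [reMul_comm, reMul_add_right, reMul_comm g, reMul_comm g]

theorem reMul_smul_left (c : ℝ) (u f : FieldVar) : reMul (c • u) f = c • reMul u f := by
  rw [reMul_comm, reMul_smul_right, reMul_comm]

theorem imMul_eq_reMul (u f : FieldVar) : imMul u f = reMul u (Complex.I • f) := by
  ext p; simp [reMul_apply, imMul_apply]; ring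

theorem mulDxInv_add_left (u v : FieldVar) (w : 𝓢(ℝ × ℝ, ℝ)) :
    mulDxInv (u + v) w = mulDxInv u w + mulDxInv v w := by
  ext p; simp [mulDxInv_apply]; ring

theorem mulDxInv_smul_left (c : ℝ) (u : FieldVar) (w : 𝓢(ℝ × ℝ, ℝ)) :
    mulDxInv (c • u) w = c • mulDxInv u w := by
  ext p; simp [mulDxInv_apply]; ring

theorem mulDxInv_add_right (u : FieldVar) (v w : 𝓢(ℝ × ℝ, ℝ)) :
    mulDxInv u (v + w) = mulDxInv u v + mulDxInv u w := by
  ext p; simp only [mulDxInv_apply, DxInv_add, add_apply]; push_cast; ring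

theorem mulDxInv_smul_right (c : ℝ) (u : FieldVar) (w : 𝓢(ℝ × ℝ, ℝ)) :
    mulDxInv u (c • w) = c • mulDxInv u w := by
  ext p
  simp only [mulDxInv_apply, DxInv_smul, smul_apply, Complex.real_smul]
  push_cast; ring

/-- `Re (u 𝒞 f)` as a bilinear map. -/
noncomputable def reMulₗ : FieldVar →ₗ[ℝ] FieldVar →ₗ[ℝ] 𝓢(ℝ × ℝ, ℝ) :=
  LinearMap.mk₂ ℝ reMul reMul_add_left reMul_smul_left reMul_add_right reMul_smul_right

/-- `u D_x⁻¹ w` as a bilinear map. -/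
noncomputable def mulDxInvₗ : FieldVar →ₗ[ℝ] 𝓢(ℝ × ℝ, ℝ) →ₗ[ℝ] FieldVar :=
  LinearMap.mk₂ ℝ mulDxInv mulDxInv_add_left mulDxInv_smul_left mulDxInv_add_right
    mulDxInv_smul_right

theorem reMulₗ_apply (u f : FieldVar) : reMulₗ u f = reMul u f := rfl

theorem mulDxInvₗ_apply (u : FieldVar) (w : 𝓢(ℝ × ℝ, ℝ)) : mulDxInvₗ u w = mulDxInv u w := rfl

/-- The real `L²` pairing `∬ Re (f ḡ) dx dy`. -/
noncomputable def pair (f g : FieldVar) : ℝ := ∫ p, (f p * conj (g p)).re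

theorem pair_eq_integral_reMul (f g : FieldVar) : pair f g = ∫ p, reMul f g p := rfl

theorem pair_comm (f g : FieldVar) : pair f g = pair g f := by
  rw [pair_eq_integral_reMul, reMul_comm, pair_eq_integral_reMul]

/-- The real `L²` pairing as a bilinear form. -/
noncomputable def pairₗ : FieldVar →ₗ[ℝ] FieldVar →ₗ[ℝ] ℝ :=
  reMulₗ.compr₂
    (SchwartzMap.integralCLM (V := ℝ) ℝ (volume : Measure (ℝ × ℝ))).toLinearMap

theorem pairₗ_apply (f g : FieldVar) : pairₗ f g = pair f g := rfl

theorem pair_add_left (f g h : FieldVar) : pair (f + g) h = pair f h + pair g h := by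
  simp [← pairₗ_apply]

theorem pair_add_right (f g h : FieldVar) : pair f (g + h) = pair f g + pair f h := by
  simp [← pairₗ_apply]

theorem pair_sub_left (f g h : FieldVar) : pair (f - g) h = pair f h - pair g h := by
  simp [← pairₗ_apply]

theorem pair_sub_right (f g h : FieldVar) : pair f (g - h) = pair f g - pair f h := by
  simp [← pairₗ_apply]

theorem pair_neg_right (f g : FieldVar) : pair f (-g) = -pair f g := by
  simp [← pairₗ_apply]

theorem pair_smul_left (c : ℝ) (f g : FieldVar) : pair (c • f) g = c * pair f g := by
  simp [← pairₗ_apply]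

theorem pair_smul_right (c : ℝ) (f g : FieldVar) : pair f (c • g) = c * pair f g := by
  simp [← pairₗ_apply]

theorem pair_I_left (f g : FieldVar) : pair (Complex.I • f) g = -pair f (Complex.I • g) := by
  rw [pair, pair, ← integral_neg]
  congr 1; ext p; simp; ring

theorem pair_I_I (f g : FieldVar) : pair (Complex.I • f) (Complex.I • g) = pair f g := by
  rw [pair_I_left, smul_smul, Complex.I_mul_I, neg_one_smul, pair_neg_right, neg_neg]

/-! ### Leibniz rules and integration by parts for directional derivatives -/

theorem lineDeriv_eq_of_hasDerivAt {F : Type} [NormedAddCommGroup F] [NormedSpace ℝ F]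
    {w : 𝓢(ℝ × ℝ, F)} {p v : ℝ × ℝ} {d : F}
    (h : HasDerivAt (fun t : ℝ => w (p + t • v)) d 0) : (∂_{v} w) p = d := by
  have := schwartz_hasDerivAt_line w p v 0
  simp only [zero_smul, add_zero] at this
  exact this.unique h

theorem lineDeriv_reMul (v : ℝ × ℝ) (f g : FieldVar) :
    ∂_{v} (reMul f g) = reMul (∂_{v} f) g + reMul f (∂_{v} g) := by
  ext p
  have hf := schwartz_hasDerivAt_line f p v 0
  have hg := schwartz_hasDerivAt_line g p v 0
  simp only [zero_smul, add_zero] at hf hg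
  have h := Complex.reCLM.hasFDerivAt.comp_hasDerivAt (0 : ℝ)
    (hf.mul (Complex.conjCLE.hasFDerivAt.comp_hasDerivAt (0 : ℝ) hg))
  refine lineDeriv_eq_of_hasDerivAt (h.congr_deriv ?_)
  simp [reMul_apply]

theorem lineDeriv_I_smul (v : ℝ × ℝ) (f : FieldVar) :
    ∂_{v} (Complex.I • f) = Complex.I • ∂_{v} f :=
  LineDeriv.lineDerivOp_smul v Complex.I f

theorem lineDeriv_imMul (v : ℝ × ℝ) (f g : FieldVar) :
    ∂_{v} (imMul f g) = imMul (∂_{v} f) g + imMul f (∂_{v} g) := by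
  simp only [imMul_eq_reMul, lineDeriv_reMul, lineDeriv_I_smul]

theorem lineDeriv_mulDxInv (v : ℝ × ℝ) (f : FieldVar) (w : 𝓢(ℝ × ℝ, ℝ)) :
    ∂_{v} (mulDxInv f w) = mulDxInv (∂_{v} f) w + mulDxInv f (∂_{v} w) := by
  ext p
  have hf := schwartz_hasDerivAt_line f p v 0
  have hw := (DxInv_hasDerivAt_line w p v).ofReal_comp
  refine lineDeriv_eq_of_hasDerivAt ?_
  simp only [mulDxInv_apply, add_apply]
  refine (hf.mul hw).congr_deriv ?_
  simp

theorem lineDeriv_fieldVar_add (v : ℝ × ℝ) (f g : FieldVar) : ∂_{v} (f + g) = ∂_{v} f + ∂_{v} g :=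
  LineDeriv.lineDerivOp_add v f g

theorem lineDeriv_fieldVar_comm (v w : ℝ × ℝ) (f : FieldVar) : ∂_{v} (∂_{w} f) = ∂_{w} (∂_{v} f) := by
  have h : ∀ (a b : ℝ × ℝ) (p : ℝ × ℝ), (∂_{a} (∂_{b} f)) p = fderiv ℝ (fderiv ℝ f) p a b := by
    intro a b p
    rw [SchwartzMap.lineDerivOp_apply_eq_fderiv]
    have : ⇑(∂_{b} f : FieldVar) = fun q => fderiv ℝ f q b :=
      funext fun q => SchwartzMap.lineDerivOp_apply_eq_fderiv b f q
    rw [this, fderiv_clm_apply]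
    · simp
    · exact ((f.smooth 2).fderiv_right (m := 1) (by norm_num)).differentiable one_ne_zero p
    · fun_prop
  ext p
  rw [h, h]
  exact ((f.smooth 2).contDiffAt.isSymmSndFDerivAt (by simp)) v w

theorem pair_lineDeriv_left (v : ℝ × ℝ) (f g : FieldVar) : pair (∂_{v} f) g = -pair f (∂_{v} g) := by
  have h := SchwartzMap.integral_bilinear_lineDerivOp_right_eq_neg_left
    (μ := (volume : Measure (ℝ × ℝ))) g f (innerSL ℝ) v
  have e : ∀ a b : ℂ, innerSL ℝ a b = (b * conj a).re := fun a b => rfl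
  rw [pair, pair]
  simp only [← e]
  rw [h]

theorem pair_Dx_left (f g : FieldVar) : pair (Dx f) g = -pair f (Dx g) :=
  pair_lineDeriv_left _ f g

theorem pair_mulDxInv_left (u g : FieldVar) (w : 𝓢(ℝ × ℝ, ℝ)) :
    pair (mulDxInv u w) g = ∫ p, DxInv w p * reMul u g p := by
  rw [pair]
  congr 1; ext p
  simp only [mulDxInv_apply, reMul_apply, Complex.mul_re, Complex.mul_im, Complex.ofReal_re,
    Complex.ofReal_im]
  ring

/-- Skew-adjointness of `D_x⁻¹` between two products. -/
theorem pair_mulDxInv_skew (a b f g : FieldVar) :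
    pair (mulDxInv a (reMul b f)) g = -pair (mulDxInv b (reMul a g)) f := by
  rw [pair_mulDxInv_left, pair_mulDxInv_left, ← neg_eq_iff_eq_neg, ← integral_mul_DxInv]
  simp only [mul_comm]

/-! ### The recursion operator -/

/-- The derivative of `u ↦ ℛ` in the direction `v`, applied to `f`. -/
noncomputable def opR' (u v f : FieldVar) : FieldVar :=
  Complex.I • (mulDxInv v (reMul u f) + mulDxInv u (reMul v f))

theorem opR_apply (u f : FieldVar) (p : ℝ × ℝ) :
    opR u f p = Complex.I * (Dx f p + u p * DxInv (reMul u f) p) := by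
  simp [opR, mulDxInv_apply, mul_add]

theorem opR'_apply (u v f : FieldVar) (p : ℝ × ℝ) :
    opR' u v f p = Complex.I * (v p * DxInv (reMul u f) p + u p * DxInv (reMul v f) p) := by
  simp [opR', mulDxInv_apply, mul_add]

theorem Dx_add (f g : FieldVar) : Dx (f + g) = Dx f + Dx g := LineDeriv.lineDerivOp_add _ f g

theorem Dx_smul (c : ℝ) (f : FieldVar) : Dx (c • f) = c • Dx f :=
  LineDeriv.lineDerivOp_smul _ c f

theorem Dx_sub (f g : FieldVar) : Dx (f - g) = Dx f - Dx g := by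
  rw [sub_eq_add_neg, ← neg_one_smul ℝ g, Dx_add, Dx_smul]; module

theorem Dx_I_smul (f : FieldVar) : Dx (Complex.I • f) = Complex.I • Dx f := lineDeriv_I_smul _ f

theorem Dx_mulDxInv_apply (f : FieldVar) (w : 𝓢(ℝ × ℝ, ℝ)) (p : ℝ × ℝ) :
    Dx (mulDxInv f w) p = Dx f p * DxInv w p + f p * w p := by
  rw [Dx, lineDeriv_mulDxInv, add_apply, mulDxInv_apply, mulDxInv_apply, DxInv_lineDeriv]
  rfl

theorem opR_add (u f g : FieldVar) : opR u (f + g) = opR u f + opR u g := by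
  simp only [opR, Dx_add, reMul_add_right, mulDxInv_add_right]
  module

theorem opR_smul (c : ℝ) (u f : FieldVar) : opR u (c • f) = c • opR u f := by
  ext p
  simp only [opR_apply, Dx_smul, reMul_smul_right, DxInv_smul, smul_apply, Complex.real_smul]
  push_cast; ring

theorem opR_sub (u f g : FieldVar) : opR u (f - g) = opR u f - opR u g := by
  rw [sub_eq_add_neg, ← neg_one_smul ℝ g, opR_add, opR_smul]; module

/-- The symplectic form `∬ Re (f conj (i g))`. -/
noncomputable def omega (f g : FieldVar) : ℝ := pair f (Complex.I • g)

theorem omega_swap (f g : FieldVar) : omega f g = -omega g f := by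
  rw [omega, omega, pair_comm, pair_I_left]

theorem omega_add_left (f g h : FieldVar) : omega (f + g) h = omega f h + omega g h :=
  pair_add_left _ _ _

theorem omega_I_left (f g : FieldVar) : omega (Complex.I • f) g = pair f g := pair_I_I f g

theorem omega_opR_eq (u f g : FieldVar) :
    omega (opR u f) g = pair (Dx f) g + pair (mulDxInv u (reMul u f)) g := by
  rw [opR, omega_I_left, pair_add_left]

/-- `ℛ` is symmetric with respect to the symplectic form. -/
theorem omega_opR (u f g : FieldVar) : omega (opR u f) g = omega f (opR u g) := by
  rw [omega_swap f, omega_opR_eq, omega_opR_eq, pair_Dx_left, pair_mulDxInv_skew, pair_comm f]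
  ring

theorem omega_opR'_eq (u v f g : FieldVar) :
    omega (opR' u v f) g = pair (mulDxInv v (reMul u f)) g - pair (mulDxInv v (reMul u g)) f := by
  rw [opR', omega_I_left, pair_add_left, pair_mulDxInv_skew u]
  ring

theorem omega_opR' (u v f g : FieldVar) : omega (opR' u v f) g = omega f (opR' u v g) := by
  rw [omega_swap f, omega_opR'_eq, omega_opR'_eq]; ring

/-- Both sides are the integral of D_x⁻¹w against Re(u ḡ), which is symmetric in u and g. This
symmetry makes the six terms of the cyclic sum below cancel in pairs. -/
theorem pair_mulDxInv_swap (u g : FieldVar) (w : 𝓢(ℝ × ℝ, ℝ)) :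
    pair (mulDxInv u w) g = pair (mulDxInv g w) u := by
  rw [pair_mulDxInv_left, pair_mulDxInv_left, reMul_comm]

/-- The two-form `ω(ℛ ·, ·)` is closed. -/
theorem omega_opR'_cyclic (u f g h : FieldVar) :
    omega (opR' u f g) h + omega (opR' u g h) f + omega (opR' u h f) g = 0 := by
  simp only [omega_opR'_eq]
  rw [pair_mulDxInv_swap f h, pair_mulDxInv_swap g f, pair_mulDxInv_swap h g]
  ring

/-- `ℛ` commutes with translations. -/
theorem lineDeriv_opR (v : ℝ × ℝ) (u f : FieldVar) :
    ∂_{v} (opR u f) = opR' u (∂_{v} u) f + opR u (∂_{v} f) := by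
  simp only [opR, opR', Dx, lineDeriv_I_smul, lineDeriv_fieldVar_add, lineDeriv_mulDxInv,
    lineDeriv_reMul, mulDxInv_add_right, lineDeriv_fieldVar_comm v]
  module

/-- The terms u D_x⁻¹Re(f ḡ) are symmetric in f and g, so only products with D_x⁻¹Re(u ·) survive.
-/
theorem opR'_sub_opR' (u f g : FieldVar) :
    opR' u f g - opR' u g f =
      Complex.I • (mulDxInv f (reMul u g) - mulDxInv g (reMul u f)) := by
  rw [opR', opR', reMul_comm f g]
  module

/-- `ℛ` is hereditary: its Nijenhuis torsion vanishes. -/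
theorem opR_hereditary (u f g : FieldVar) :
    opR' u (opR u f) g - opR' u (opR u g) f = opR u (opR' u f g - opR' u g f) := by
  set Q := opR' u f g - opR' u g f with hQ
  rw [opR'_sub_opR'] at hQ
  -- The local part of the left side is an exact x-derivative, so D_x⁻¹ removes it. The nonlocal
  -- part reassembles into Re(u Q̄), which is what the term u D_x⁻¹Re(u Q̄) in ℛQ requires.
  have key : reMul (opR u f) g - reMul (opR u g) f =
      -(∂_{((1, 0) : ℝ × ℝ)} (imMul f g)) + reMul u Q := by
    rw [hQ, lineDeriv_imMul]
    ext p
    simp only [sub_apply, add_apply, neg_apply, smul_apply, reMul_apply, imMul_apply, opR_apply,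
      mulDxInv_apply, smul_eq_mul, Dx]
    simp
    ring
  have key2 : ∀ p, DxInv (reMul (opR u f) g) p - DxInv (reMul (opR u g) f) p =
      -imMul f g p + DxInv (reMul u Q) p := by
    intro p
    rw [← DxInv_sub, key, DxInv_add, DxInv_neg, DxInv_lineDeriv]
  ext p
  have k := key2 p
  have k' : (DxInv (reMul (opR u f) g) p : ℂ) =
      DxInv (reMul (opR u g) f) p + (-imMul f g p + DxInv (reMul u Q) p : ℝ) := by
    rw [← k]; push_cast; ring
  have hD : Dx Q p = Complex.I * (Dx f p * DxInv (reMul u g) p + f p * reMul u g p -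
      (Dx g p * DxInv (reMul u f) p + g p * reMul u f p)) := by
    rw [hQ, Dx_I_smul, Dx_sub]
    simp only [smul_apply, sub_apply, Dx_mulDxInv_apply, smul_eq_mul]
  simp only [sub_apply, opR'_apply]
  rw [opR_apply u Q, hD, opR_apply u f, opR_apply u g, k', reMul_apply, reMul_apply, imMul_apply]
  apply Complex.ext
  · simp; ring
  · simp; ring

/-! ### The flows and their linearizations -/

theorem flow_succ (n : ℕ) (u : FieldVar) : flow (n + 1) u = opR u (flow n u) :=
  Function.iterate_succ_apply' _ _ _

/-- The linearization of `ℛⁿ(u_y)` at `u` in the direction `φ`. -/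
noncomputable def dflow : ℕ → FieldVar → FieldVar → FieldVar
  | 0, _, φ => Dy φ
  | n + 1, u, φ => opR' u φ (flow n u) + opR u (dflow n u φ)

/-- Translation equivariance of the flows. -/
theorem dflow_lineDeriv (n : ℕ) (v : ℝ × ℝ) (u : FieldVar) :
    dflow n u (∂_{v} u) = ∂_{v} (flow n u) := by
  induction n with
  | zero => exact lineDeriv_fieldVar_comm _ _ _
  | succ n ih => rw [dflow, ih, flow_succ, lineDeriv_opR]

/-- The Lie derivative of `ℛ` along each flow vanishes. -/
theorem opR'_flow (n : ℕ) (u f : FieldVar) :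
    opR' u (flow n u) f + opR u (dflow n u f) = dflow n u (opR u f) := by
  induction n generalizing f with
  | zero => exact (lineDeriv_opR (0, 1) u f).symm
  | succ n ih =>
    -- Zero torsion trades the variation of ℛ along ℛX for the variation along X, to which the
    -- induction hypothesis applies.
    have h := opR_hereditary u (flow n u) f
    rw [opR_sub] at h
    rw [dflow, dflow, ← ih, flow_succ, opR_add, opR_add, sub_eq_iff_eq_add.1 h]
    abel

theorem dflow_zero_flow (n : ℕ) (u : FieldVar) :
    dflow 0 u (flow n u) = dflow n u (flow 0 u) :=
  (dflow_lineDeriv n (0, 1) u).symm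

/-- The flows commute. -/
theorem dflow_flow_comm (m n : ℕ) (u : FieldVar) :
    dflow m u (flow n u) = dflow n u (flow m u) := by
  induction m with
  | zero => exact dflow_zero_flow n u
  | succ m ih =>
    rw [flow_succ, ← opR'_flow, dflow, ih]

/-- The linearized flows are infinitesimally symplectic. -/
theorem omega_dflow (n : ℕ) (u f g : FieldVar) :
    omega (dflow n u f) g = omega (dflow n u g) f := by
  induction n generalizing f g with
  | zero =>
    rw [omega_swap _ f, omega, omega, dflow, dflow, Dy, pair_lineDeriv_left, lineDeriv_I_smul]
    rfl
  | succ n ih =>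
    -- Closedness turns the two variations of ℛ along f and g into one along the flow. Invariance of
    -- ℛ along the flow rewrites that one through `dflow`, and the induction hypothesis applies to
    -- the pair ℛg, f.
    have h1 := omega_opR'_cyclic u f (flow n u) g
    have h2 := opR'_flow n u g
    have h3 := congrArg (fun q => omega q f) h2
    simp only [omega_add_left] at h3
    rw [ih] at h3
    simp only [dflow, omega_add_left]
    have h4 := omega_opR u (dflow n u f) g
    have h5 := omega_opR' u g f (flow n u)
    have h6 := omega_swap f (opR' u g (flow n u))
    linarith

/-! ### Curves that are finite sums with scalar coefficients -/

section FiniteSum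

variable {X V W Z : Type*} [TopologicalSpace X] [AddCommGroup V] [Module ℝ V]
  [AddCommGroup W] [Module ℝ W] [AddCommGroup Z] [Module ℝ Z]

/-- `f` is a finite sum of fixed vectors with continuous scalar coefficients. -/
def IsFiniteSum (f : X → V) : Prop :=
  f ∈ Submodule.span ℝ {g : X → V | ∃ (a : C(X, ℝ)) (c : V), g = fun x => a x • c}

theorem IsFiniteSum.coeff_smul (a : C(X, ℝ)) (c : V) : IsFiniteSum fun x => a x • c :=
  Submodule.subset_span ⟨a, c, rfl⟩

theorem IsFiniteSum.const (c : V) : IsFiniteSum fun _ : X => c := by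
  simpa using IsFiniteSum.coeff_smul (1 : C(X, ℝ)) c

theorem IsFiniteSum.add {f g : X → V} (hf : IsFiniteSum f) (hg : IsFiniteSum g) :
    IsFiniteSum fun x => f x + g x :=
  Submodule.add_mem _ hf hg

theorem IsFiniteSum.const_smul {f : X → V} (hf : IsFiniteSum f) (r : ℝ) :
    IsFiniteSum fun x => r • f x :=
  Submodule.smul_mem _ r hf

theorem IsFiniteSum.continuous_smul {f : X → V} (hf : IsFiniteSum f) (a : C(X, ℝ)) :
    IsFiniteSum fun x => a x • f x := by
  induction hf using Submodule.span_induction with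
  | mem f hf =>
    obtain ⟨b, c, rfl⟩ := hf
    simpa [smul_smul] using IsFiniteSum.coeff_smul (a * b) c
  | zero => simpa using IsFiniteSum.const (X := X) (0 : V)
  | add f g _ _ hf hg => simpa using hf.add hg
  | smul r f _ hf => simpa [smul_comm r] using hf.const_smul r

theorem IsFiniteSum.map {f : X → V} (hf : IsFiniteSum f) (T : V →ₗ[ℝ] W) :
    IsFiniteSum fun x => T (f x) := by
  induction hf using Submodule.span_induction with
  | mem f hf =>
    obtain ⟨b, c, rfl⟩ := hf
    simpa using IsFiniteSum.coeff_smul b (T c)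
  | zero => simpa using IsFiniteSum.const (X := X) (0 : W)
  | add f g _ _ hf hg => simpa using hf.add hg
  | smul r f _ hf => simpa using hf.const_smul r

theorem IsFiniteSum.map₂ {f : X → V} {g : X → W} (hf : IsFiniteSum f) (hg : IsFiniteSum g)
    (B : V →ₗ[ℝ] W →ₗ[ℝ] Z) : IsFiniteSum fun x => B (f x) (g x) := by
  induction hf using Submodule.span_induction with
  | mem f hf =>
    obtain ⟨b, c, rfl⟩ := hf
    simpa using (hg.map (B c)).continuous_smul b
  | zero => simpa using IsFiniteSum.const (X := X) (0 : Z)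
  | add f g _ _ hf hg => simpa using hf.add hg
  | smul r f _ hf => simpa using hf.const_smul r

theorem IsFiniteSum.continuous [TopologicalSpace V] [ContinuousAdd V] [ContinuousSMul ℝ V]
    {f : X → V} (hf : IsFiniteSum f) : Continuous f := by
  induction hf using Submodule.span_induction with
  | mem f hf =>
    obtain ⟨b, c, rfl⟩ := hf
    fun_prop
  | zero => exact continuous_const
  | add f g _ _ hf hg => exact hf.add hg
  | smul r f _ hf => exact hf.const_smul r

/-- A second-order expansion of `γ` at `0` with first-order coefficient `v` and a remainder that
is a finite sum. -/
def HasExpansion (γ : ℝ → V) (v : V) : Prop :=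
  ∃ ρ : ℝ → V, IsFiniteSum ρ ∧ ∀ ε, γ ε = γ 0 + ε • v + ε ^ 2 • ρ ε

theorem HasExpansion.congr_coeff {γ : ℝ → V} {v w : V} (h : HasExpansion γ v) (e : v = w) :
    HasExpansion γ w :=
  e ▸ h

theorem HasExpansion.line (u φ : V) : HasExpansion (fun ε : ℝ => u + ε • φ) φ :=
  ⟨fun _ => 0, .const 0, fun ε => by simp⟩

theorem HasExpansion.add {γ η : ℝ → V} {v w : V} (hγ : HasExpansion γ v)
    (hη : HasExpansion η w) : HasExpansion (fun ε => γ ε + η ε) (v + w) := by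
  obtain ⟨ρ, hρ, h⟩ := hγ
  obtain ⟨σ, hσ, h'⟩ := hη
  refine ⟨_, hρ.add hσ, fun ε => ?_⟩
  simp only
  rw [h ε, h' ε]
  module

theorem HasExpansion.map {γ : ℝ → V} {v : V} (hγ : HasExpansion γ v) (T : V →ₗ[ℝ] W) :
    HasExpansion (fun ε => T (γ ε)) (T v) := by
  obtain ⟨ρ, hρ, h⟩ := hγ
  refine ⟨_, hρ.map T, fun ε => ?_⟩
  simp only
  rw [h ε]
  simp

/-- Multiplying out two expansions leaves a remainder that is again a finite sum, so no continuity
of `B` is needed. This covers u D_x⁻¹w without proving continuity in w for the Schwartz topology. -/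
theorem HasExpansion.map₂ {γ : ℝ → V} {η : ℝ → W} {v : V} {w : W} (hγ : HasExpansion γ v)
    (hη : HasExpansion η w) (B : V →ₗ[ℝ] W →ₗ[ℝ] Z) :
    HasExpansion (fun ε => B (γ ε) (η ε)) (B v (η 0) + B (γ 0) w) := by
  obtain ⟨ρ, hρ, h⟩ := hγ
  obtain ⟨σ, hσ, h'⟩ := hη
  let t : C(ℝ, ℝ) := ContinuousMap.id ℝ
  refine ⟨_, (((IsFiniteSum.const (B v w)).add (hσ.map (B (γ 0)))).add
    (hρ.map (B.flip (η 0)))).add ((((hσ.map (B v)).add (hρ.map (B.flip w))).continuous_smul t).add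
    ((hρ.map₂ hσ B).continuous_smul (t * t))), fun ε => ?_⟩
  simp only
  rw [h ε, h' ε]
  simp only [map_add, map_smul, LinearMap.add_apply, LinearMap.smul_apply, LinearMap.flip_apply,
    t, ContinuousMap.id_apply, ContinuousMap.mul_apply]
  module

/-- A finite sum is continuous in any topological vector space, so ε • ρ ε tends to 0. This is the
little-o condition without a norm. -/
theorem HasExpansion.hasDerivAt [TopologicalSpace V] [ContinuousAdd V] [ContinuousSMul ℝ V]
    {γ : ℝ → V} {v : V} (hγ : HasExpansion γ v) : HasDerivAt γ v 0 := by
  obtain ⟨ρ, hρ, h⟩ := hγ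
  have hc : Filter.Tendsto (fun ε : ℝ => ε • ρ ε) (nhds 0) (nhds 0) := by
    have h : Continuous fun ε : ℝ => ε • ρ ε := continuous_id.smul hρ.continuous
    simpa using h.tendsto 0
  have hl := ((Asymptotics.isLittleOTVS_one (𝕜 := ℝ)).2 hc).smul_left (fun ε : ℝ => ε)
  rw [hasDerivAt_iff_hasFDerivAt, hasFDerivAt_iff_isLittleOTVS]
  refine hl.congr (fun ε => ?_) (fun ε => by simp)
  rw [h ε]
  simp only [smul_smul, ContinuousLinearMap.toSpanSingleton_apply, sub_zero]
  module

end FiniteSum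

/-- `D_x` as a real linear map. -/
noncomputable def Dxₗ : FieldVar →ₗ[ℝ] FieldVar where
  toFun := Dx
  map_add' := Dx_add
  map_smul' := Dx_smul

/-- Multiplication by `i` as a real linear map. -/
noncomputable def mulIₗ : FieldVar →ₗ[ℝ] FieldVar where
  toFun f := Complex.I • f
  map_add' _ _ := smul_add _ _ _
  map_smul' _ _ := smul_comm _ _ _

/-- `D_y` as a real linear map. -/
noncomputable def Dyₗ : FieldVar →ₗ[ℝ] FieldVar where
  toFun := Dy
  map_add' f g := LineDeriv.lineDerivOp_add _ f g
  map_smul' c f := LineDeriv.lineDerivOp_smul _ c f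

theorem IsFiniteSum.opR {X : Type*} [TopologicalSpace X] {u f : X → FieldVar}
    (hu : IsFiniteSum u) (hf : IsFiniteSum f) : IsFiniteSum fun x => opR (u x) (f x) :=
  ((hf.map Dxₗ).add (hu.map₂ (hu.map₂ hf reMulₗ) mulDxInvₗ)).map mulIₗ

theorem IsFiniteSum.flow {X : Type*} [TopologicalSpace X] {u : X → FieldVar}
    (hu : IsFiniteSum u) (n : ℕ) : IsFiniteSum fun x => flow n (u x) := by
  induction n with
  | zero => exact hu.map Dyₗ
  | succ n ih => simpa only [flow_succ] using hu.opR ih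

theorem IsFiniteSum.dflow {X : Type*} [TopologicalSpace X] {u φ : X → FieldVar}
    (hu : IsFiniteSum u) (hφ : IsFiniteSum φ) (n : ℕ) :
    IsFiniteSum fun x => dflow n (u x) (φ x) := by
  induction n with
  | zero => exact hφ.map Dyₗ
  | succ n ih =>
    exact (((hφ.map₂ (hu.map₂ (hu.flow n) reMulₗ) mulDxInvₗ).add
      (hu.map₂ (hφ.map₂ (hu.flow n) reMulₗ) mulDxInvₗ)).map mulIₗ).add (hu.opR ih)

/-- `dflow n u φ` is the derivative of `ℛⁿ(u_y)` in the direction `φ`. -/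
theorem hasExpansion_flow (n : ℕ) (u φ : FieldVar) :
    HasExpansion (fun ε : ℝ => flow n (u + ε • φ)) (dflow n u φ) := by
  induction n with
  | zero => exact (HasExpansion.line u φ).map Dyₗ
  | succ n ih =>
    have hu := HasExpansion.line u φ
    have h := ((ih.map Dxₗ).add (hu.map₂ (hu.map₂ ih reMulₗ) mulDxInvₗ)).map mulIₗ
    simp only [flow_succ]
    refine h.congr_coeff ?_
    simp only [zero_smul, add_zero, map_add, reMulₗ_apply, mulDxInvₗ_apply]
    simp only [dflow, opR, opR', mulIₗ, Dxₗ, LinearMap.coe_mk, AddHom.coe_mk]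
    module

theorem hasDerivAt_flow (n : ℕ) (u φ : FieldVar) :
    HasDerivAt (fun ε : ℝ => flow n (u + ε • φ)) (dflow n u φ) 0 :=
  (hasExpansion_flow n u φ).hasDerivAt

/-! ### Dilations -/

theorem hasTemperateGrowth_fst : (fun p : ℝ × ℝ => p.1).HasTemperateGrowth :=
  (ContinuousLinearMap.fst ℝ ℝ ℝ).hasTemperateGrowth

/-- Multiplication by the coordinate `x`. -/
noncomputable def mulX {F : Type} [NormedAddCommGroup F] [NormedSpace ℝ F] (f : 𝓢(ℝ × ℝ, F)) :
    𝓢(ℝ × ℝ, F) :=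
  SchwartzMap.smulLeftCLM F (fun p : ℝ × ℝ => p.1) f

theorem mulX_apply {F : Type} [NormedAddCommGroup F] [NormedSpace ℝ F] (f : 𝓢(ℝ × ℝ, F))
    (p : ℝ × ℝ) : mulX f p = p.1 • f p := by
  rw [mulX, SchwartzMap.smulLeftCLM_apply_apply hasTemperateGrowth_fst]

theorem lineDeriv_mulX {F : Type} [NormedAddCommGroup F] [NormedSpace ℝ F] (v : ℝ × ℝ)
    (f : 𝓢(ℝ × ℝ, F)) (p : ℝ × ℝ) : (∂_{v} (mulX f)) p = v.1 • f p + p.1 • (∂_{v} f) p := by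
  have hf := schwartz_hasDerivAt_line f p v 0
  have hx : HasDerivAt (fun t : ℝ => (p + t • v).1) v.1 0 := by
    simpa using ((hasDerivAt_id (0 : ℝ)).mul_const v.1).const_add p.1
  refine lineDeriv_eq_of_hasDerivAt ?_
  simp only [mulX_apply]
  refine (hx.smul hf).congr_deriv ?_
  simp [add_comm]

/-- The generator `u ↦ D_x (x u)` of the dilations in `x`. -/
noncomputable def dilation (f : FieldVar) : FieldVar := Dx (mulX f)

/-- The generator of the dilations as a real linear map. -/
noncomputable def dilationₗ : FieldVar →ₗ[ℝ] FieldVar :=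
  Dxₗ ∘ₗ (SchwartzMap.smulLeftCLM (𝕜 := ℝ) ℂ (fun p : ℝ × ℝ => p.1)).toLinearMap

theorem dilation_apply (f : FieldVar) (p : ℝ × ℝ) : dilation f p = f p + p.1 * Dx f p := by
  rw [dilation, Dx, lineDeriv_mulX]
  simp [Dx]

theorem dilation_I_smul (f : FieldVar) : dilation (Complex.I • f) = Complex.I • dilation f := by
  ext p
  simp only [dilation_apply, smul_apply, Dx_I_smul, smul_eq_mul]
  ring

theorem Dy_dilation (f : FieldVar) : Dy (dilation f) = dilation (Dy f) := by
  rw [dilation, Dx, Dy, lineDeriv_fieldVar_comm, dilation, Dx]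
  congr 1
  ext p
  rw [lineDeriv_mulX, mulX_apply]
  simp [Dy]

theorem Dx_dilation_apply (f : FieldVar) (p : ℝ × ℝ) :
    Dx (dilation f) p = 2 * Dx f p + p.1 * Dx (Dx f) p := by
  have h : dilation f = f + mulX (Dx f) := by
    ext p; rw [dilation_apply, add_apply, mulX_apply, Complex.real_smul]
  rw [h, Dx_add, add_apply, Dx, Dx, lineDeriv_mulX]
  simp [Dx]
  ring

/-- `ℛ` has weight one under dilations. -/
theorem opR_dilation (u f : FieldVar) :
    opR' u (dilation u) f + opR u (dilation f) = opR u f + dilation (opR u f) := by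
  -- Both factors contribute x ∂_x and one unit of weight. Since 2w + x w_x = w + ∂_x(x w), applying
  -- D_x⁻¹ leaves the local correction x w.
  have key : reMul (dilation u) f + reMul u (dilation f) =
      reMul u f + ∂_{((1, 0) : ℝ × ℝ)} (mulX (reMul u f)) := by
    ext p
    rw [add_apply, add_apply, lineDeriv_mulX, lineDeriv_reMul]
    simp only [add_apply, reMul_apply, dilation_apply, Dx]
    simp
    ring
  have key2 : ∀ p, DxInv (reMul (dilation u) f) p + DxInv (reMul u (dilation f)) p =
      DxInv (reMul u f) p + p.1 * reMul u f p := by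
    intro p
    rw [← DxInv_add, key, DxInv_add, DxInv_lineDeriv, mulX_apply, smul_eq_mul]
  ext p
  have k : (DxInv (reMul (dilation u) f) p : ℂ) =
      (DxInv (reMul u f) p + p.1 * reMul u f p : ℝ) - DxInv (reMul u (dilation f)) p := by
    rw [← key2]; push_cast; ring
  have hD : Dx (opR u f) p = Complex.I * (Dx (Dx f) p + (Dx u p * DxInv (reMul u f) p +
      u p * reMul u f p)) := by
    rw [opR, Dx_I_smul, Dx_add, smul_apply, add_apply, Dx_mulDxInv_apply, smul_eq_mul]
  simp only [add_apply, opR'_apply, dilation_apply _ p, hD]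
  rw [opR_apply, opR_apply, Dx_dilation_apply, k]
  push_cast
  ring

/-- Euler's identity for a field of weight n: D_y commutes with the dilations and each ℛ adds one to
the weight. -/
theorem dflow_dilation (n : ℕ) (u : FieldVar) :
    dflow n u (dilation u) = (n : ℝ) • flow n u + dilation (flow n u) := by
  induction n with
  | zero =>
    rw [Nat.cast_zero, zero_smul, zero_add]
    exact Dy_dilation u
  | succ n ih =>
    have h := opR_dilation u (flow n u)
    rw [dflow, ih, opR_add, opR_smul, flow_succ, add_left_comm, h]
    push_cast
    module

theorem pair_mulX (f g : FieldVar) : pair (mulX f) g = pair f (mulX g) := by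
  rw [pair, pair]
  congr 1; ext p
  simp [mulX_apply]
  ring

theorem mulX_Dx (f : FieldVar) : mulX (Dx f) = dilation f - f := by
  ext p
  rw [sub_apply, dilation_apply, mulX_apply, Complex.real_smul]
  ring

/-- The adjoint of 1 + x D_x is -x D_x. -/
theorem pair_dilation_right (f g : FieldVar) : pair f (dilation g) = pair f g - pair (dilation f) g := by
  have h := pair_Dx_left f (mulX g)
  rw [← pair_mulX, mulX_Dx, pair_sub_left] at h
  rw [dilation]
  linarith

/-! ### The Hamiltonians -/

/-- As a function of u this has zero derivative: the linearized flow is symplectic, it sends u_x to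
the x-derivative of the flow, and D_x is skew-adjoint. It is therefore constant on the ray from 0 to
u, and it vanishes at 0. This conservation law gives the zero mean that makes the Hamiltonian
integrals converge. -/
theorem omega_flow_Dx (n : ℕ) (u : FieldVar) : omega (flow n u) (Dx u) = 0 := by
  have hd : ∀ v φ : FieldVar,
      HasDerivAt (fun ε : ℝ => omega (flow n (v + ε • φ)) (Dx (v + ε • φ))) 0 0 := by
    intro v φ
    have h := ((hasExpansion_flow n v φ).map₂ ((HasExpansion.line v φ).map Dxₗ)
      (pairₗ.compl₂ mulIₗ)).hasDerivAt
    refine h.congr_deriv ?_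
    simp only [zero_smul, add_zero]
    change omega (dflow n v φ) (Dx v) + omega (flow n v) (Dx φ) = 0
    rw [omega_dflow n v φ, Dx, dflow_lineDeriv, omega, omega, pair_lineDeriv_left,
      lineDeriv_I_smul, Dx]
    ring
  have hd' : ∀ t : ℝ, HasDerivAt (fun ε : ℝ => omega (flow n (ε • u)) (Dx (ε • u))) 0 t := by
    intro t
    have h := hd (t • u) u
    have h2 := HasDerivAt.scomp (g₁ := fun ε : ℝ => omega (flow n (t • u + ε • u))
      (Dx (t • u + ε • u))) t (by simpa using h) ((hasDerivAt_id t).sub_const t)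
    simpa [Function.comp_def, ← add_smul] using h2
  have hc := is_const_of_deriv_eq_zero (fun t => (hd' t).differentiableAt)
    (fun t => (hd' t).deriv) 1 0
  simp only [one_smul, zero_smul] at hc
  rw [hc, show Dx 0 = 0 from Dxₗ.map_zero, omega, smul_zero]
  exact (pairₗ _).map_zero

theorem density_eq (n : ℕ) (u : FieldVar) (p : ℝ × ℝ) :
    density n u p = 2 / (1 + (n : ℝ)) * DxInv (reMul (flow (n + 1) u) u) p := by
  rw [density]
  congr 2
  ext q
  rw [reMul_apply, mul_comm]

/-- The hypothesis makes the nonlocal term of ℛ pointwise orthogonal to f. It is applied with f = u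
and f = x u. -/
theorem pair_flow_succ (n : ℕ) (u f : FieldVar) (hf : ∀ p, (Complex.I * u p * conj (f p)).re = 0) :
    pair (flow (n + 1) u) f = omega (flow n u) (Dx f) := by
  have h : pair (flow (n + 1) u) f = pair (Complex.I • Dx (flow n u)) f := by
    rw [pair, pair]
    congr 1; ext p
    have e : flow (n + 1) u p * conj (f p) = (Complex.I • Dx (flow n u)) p * conj (f p) +
        (DxInv (reMul u (flow n u)) p : ℝ) * (Complex.I * u p * conj (f p)) := by
      rw [flow_succ, opR_apply, smul_apply, smul_eq_mul]
      ring
    rw [e, Complex.add_re, Complex.re_ofReal_mul, hf, mul_zero, add_zero]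
  rw [h, pair_I_left, pair_Dx_left, Dx_I_smul, neg_neg, omega]

theorem integral_reMul_flow (n : ℕ) (u : FieldVar) : ∫ p, reMul (flow (n + 1) u) u p = 0 := by
  rw [← pair_eq_integral_reMul, pair_flow_succ, omega_flow_Dx]
  intro p
  rw [mul_assoc, Complex.mul_conj]
  simp

theorem integrable_density (n : ℕ) (u : FieldVar) (x : ℝ) :
    Integrable fun y : ℝ => density n u (x, y) := by
  simp only [density_eq]
  exact (integrable_DxInv_vertical _ x).const_mul _

theorem integrable_integral_density (n : ℕ) (u : FieldVar) :
    Integrable fun x : ℝ => ∫ y : ℝ, density n u (x, y) := by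
  simp only [density_eq, integral_const_mul]
  exact (integrable_integral_DxInv _ (integral_reMul_flow n u)).const_mul _

/-- The first x-moment of Re(ū ℛⁿ⁺¹u_y) is its pairing with x u. Moving D_x across turns x u into
`dilation u`. -/
theorem hamiltonian_eq (n : ℕ) (u : FieldVar) :
    hamiltonian n u = 2 / (1 + (n : ℝ)) * -omega (flow n u) (dilation u) := by
  have h : ∫ z : ℝ × ℝ, z.1 * reMul (flow (n + 1) u) u z = pair (flow (n + 1) u) (mulX u) := by
    rw [pair]
    congr 1; ext z
    rw [reMul_apply, mulX_apply, Complex.real_smul, map_mul, Complex.conj_ofReal, mul_left_comm,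
      Complex.re_ofReal_mul]
  simp only [hamiltonian, density_eq, integral_const_mul]
  rw [integral_integral_DxInv _ (integral_reMul_flow n u), h, pair_flow_succ]
  · rfl
  · intro p
    rw [mulX_apply, Complex.real_smul, map_mul, mul_left_comm, mul_assoc Complex.I, Complex.mul_conj]
    simp

/-- `i ℛⁿ(u_y)` is the variational derivative of the `n`-th Hamiltonian. -/
theorem isVarDeriv_hamiltonian (n : ℕ) :
    IsVarDeriv (hamiltonian n) fun u => Complex.I • flow n u := by
  intro u φ
  have h := (((hasExpansion_flow n u φ).map₂ ((HasExpansion.line u φ).map dilationₗ)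
      (pairₗ.compl₂ mulIₗ)).hasDerivAt).const_mul (-(2 / (1 + (n : ℝ))))
  have e : ∀ v, hamiltonian n v = -(2 / (1 + (n : ℝ))) * omega (flow n v) (dilation v) :=
    fun v => by rw [hamiltonian_eq]; ring
  simp only [e]
  refine h.congr_deriv ?_
  simp only [zero_smul, add_zero]
  change -(2 / (1 + (n : ℝ))) * (omega (dflow n u φ) (dilation u) +
    omega (flow n u) (dilation φ)) = _
  have hr : ∫ p, 2 * ((Complex.I • flow n u) p * conj (φ p)).re = 2 * pair (Complex.I • flow n u) φ :=
    integral_const_mul _ _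
  -- The terms with `dilation (flow n u)` cancel. Weight n plus the 1 from the adjoint of the
  -- dilation gives n + 1, which the prefactor 2/(1+n) normalizes.
  have h1 : omega (flow n u) (dilation φ) =
      omega (flow n u) φ - omega (dilation (flow n u)) φ := by
    rw [omega, ← dilation_I_smul, pair_dilation_right]; rfl
  have hn : (1 + (n : ℝ)) ≠ 0 := by positivity
  rw [hr, pair_I_left, omega_dflow, dflow_dilation, omega_add_left, h1, omega, pair_smul_left]
  change _ = 2 * -omega (flow n u) φ
  rw [← omega]
  field_simp
  ring

theorem isFunctional_hamiltonian (n : ℕ) :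
    IsFunctional (hamiltonian n) fun u => Complex.I • flow n u := by
  refine ⟨isVarDeriv_hamiltonian n, fun u φ => Complex.I • dflow n u φ, fun u φ => ?_,
    fun u φ ψ => ?_⟩
  · exact ((hasExpansion_flow n u φ).map mulIₗ).hasDerivAt
  · have hu : IsFiniteSum fun s : ℝ × ℝ => u + s.1 • φ + s.2 • ψ :=
      ((IsFiniteSum.const u).add (.coeff_smul ⟨Prod.fst, continuous_fst⟩ φ)).add
        (.coeff_smul ⟨Prod.snd, continuous_snd⟩ ψ)
    exact ((hu.dflow (IsFiniteSum.const φ) n).map mulIₗ).continuous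

/-! ### Symmetry of second derivatives in the plane -/

theorem hasFDerivAt_of_continuous_partials {Φ A B : ℝ × ℝ → ℝ}
    (hA : ∀ s t, HasDerivAt (fun r => Φ (r, t)) (A (s, t)) s)
    (hB : ∀ s t, HasDerivAt (fun r => Φ (s, r)) (B (s, t)) t)
    (cA : Continuous A) (cB : Continuous B) (p : ℝ × ℝ) :
    HasFDerivAt Φ (A p • ContinuousLinearMap.fst ℝ ℝ ℝ + B p • ContinuousLinearMap.snd ℝ ℝ ℝ) p := by
  have c : Continuous fun a : ℝ => ContinuousLinearMap.toSpanSingleton ℝ a :=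
    (ContinuousLinearMap.toSpanSingletonCLE (𝕜 := ℝ) (E := ℝ)).continuous
  have h := hasStrictFDerivAt_uncurry_coprod (𝕜 := ℝ) (u := p) (f := fun s t => Φ (s, t))
    (f₁ := fun s t => ContinuousLinearMap.toSpanSingleton ℝ (A (s, t)))
    (f₂ := fun s t => ContinuousLinearMap.toSpanSingleton ℝ (B (s, t)))
    (Filter.Eventually.of_forall fun v => (hA v.1 v.2).hasFDerivAt)
    (Filter.Eventually.of_forall fun v => (hB v.1 v.2).hasFDerivAt)
    (c.comp cA).continuousAt (c.comp cB).continuousAt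
  refine h.hasFDerivAt.congr_fderiv ?_
  ext <;> simp [Function.HasUncurry.uncurry]

theorem mixed_partials_eq {Φ A B A₁ A₂ B₁ B₂ : ℝ × ℝ → ℝ}
    (hA : ∀ s t, HasDerivAt (fun r => Φ (r, t)) (A (s, t)) s)
    (hB : ∀ s t, HasDerivAt (fun r => Φ (s, r)) (B (s, t)) t)
    (hA₁ : ∀ s t, HasDerivAt (fun r => A (r, t)) (A₁ (s, t)) s)
    (hA₂ : ∀ s t, HasDerivAt (fun r => A (s, r)) (A₂ (s, t)) t)
    (hB₁ : ∀ s t, HasDerivAt (fun r => B (r, t)) (B₁ (s, t)) s)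
    (hB₂ : ∀ s t, HasDerivAt (fun r => B (s, r)) (B₂ (s, t)) t)
    (cA₁ : Continuous A₁) (cA₂ : Continuous A₂) (cB₁ : Continuous B₁) (cB₂ : Continuous B₂)
    (p : ℝ × ℝ) : A₂ p = B₁ p := by
  have dA := hasFDerivAt_of_continuous_partials hA₁ hA₂ cA₁ cA₂
  have dB := hasFDerivAt_of_continuous_partials hB₁ hB₂ cB₁ cB₂
  have cA : Continuous A := continuous_iff_continuousAt.2 fun q => (dA q).continuousAt
  have cB : Continuous B := continuous_iff_continuousAt.2 fun q => (dB q).continuousAt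
  have h := second_derivative_symmetric (hasFDerivAt_of_continuous_partials hA hB cA cB)
    (((dA p).smul_const (ContinuousLinearMap.fst ℝ ℝ ℝ)).add
      ((dB p).smul_const (ContinuousLinearMap.snd ℝ ℝ ℝ))) (0, 1) (1, 0)
  simpa using h

/-! ### Differentiating pairings of curves -/

theorem hasDerivAt_clm_comp {V : Type*} [AddCommGroup V] [Module ℝ V] [TopologicalSpace V]
    [ContinuousSMul ℝ V] {E : Type*} [NormedAddCommGroup E] [NormedSpace ℝ E] (T : V →L[ℝ] E)
    {γ : ℝ → V} {v : V} {t : ℝ} (h : HasDerivAt γ v t) : HasDerivAt (fun s => T (γ s)) (T v) t := by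
  rw [hasDerivAt_iff_hasFDerivAt, hasFDerivAt_iff_isLittleOTVS] at h ⊢
  refine (T.isBigOTVS_fun_comp.trans_isLittleOTVS h).congr_left fun s => ?_
  simp

/-- The embedding of the Schwartz space into `L²`. -/
noncomputable def toL2 : FieldVar →L[ℝ] Lp ℂ 2 (volume : Measure (ℝ × ℝ)) :=
  SchwartzMap.toLpCLM ℝ ℂ 2 volume

theorem toL2_coe (f : FieldVar) : toL2 f =ᵐ[volume] f := f.coeFn_toLp 2 volume

theorem pair_eq_inner (f g : FieldVar) : pair f g = inner ℝ (toL2 g) (toL2 f) := by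
  rw [L2.inner_def, pair]
  refine integral_congr_ae ?_
  filter_upwards [toL2_coe f, toL2_coe g] with p hf hg
  rw [hf, hg]
  rfl

/-- The operator `T` need only be continuous from the Schwartz space to L², after which the product
rule is the one for the L² inner product. -/
theorem hasDerivAt_pair_of_clm (T : FieldVar →ₗ[ℝ] FieldVar) (hT : Continuous fun f => toL2 (T f))
    {γ η : ℝ → FieldVar} {v w : FieldVar} (hγ : HasDerivAt γ v 0) (hη : HasDerivAt η w 0) :
    HasDerivAt (fun ε => pair (T (γ ε)) (η ε)) (pair (T v) (η 0) + pair (T (γ 0)) w) 0 := by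
  let T' : FieldVar →L[ℝ] Lp ℂ 2 (volume : Measure (ℝ × ℝ)) :=
    ⟨toL2.toLinearMap ∘ₗ T, hT⟩
  have h1 := hasDerivAt_clm_comp T' hγ
  have h2 := hasDerivAt_clm_comp toL2 hη
  simp only [pair_eq_inner]
  exact h2.inner ℝ h1

theorem continuous_reMul_right (b : FieldVar) : Continuous (reMul b) := by
  unfold reMul mulConj
  fun_prop

theorem norm_toL2_mulDxInv_le (a : FieldVar) (w : 𝓢(ℝ × ℝ, ℝ)) {M : ℝ}
    (hM : ∀ p, |DxInv w p| ≤ M) : ‖toL2 (mulDxInv a w)‖ ≤ M * ‖toL2 a‖ := by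
  refine Lp.norm_le_mul_norm_of_ae_le_mul ?_
  filter_upwards [toL2_coe (mulDxInv a w), toL2_coe a] with p h1 h2
  rw [h1, h2, mulDxInv_apply, norm_mul, Complex.norm_real, Real.norm_eq_abs, mul_comm]
  exact mul_le_mul_of_nonneg_right (hM p) (norm_nonneg _)

theorem continuous_toL2_mulDxInv (a : FieldVar) :
    Continuous fun w : 𝓢(ℝ × ℝ, ℝ) => toL2 (mulDxInv a w) := by
  obtain ⟨C, hC0, hC⟩ := DxInv_bound
  refine (SchwartzMap.mkCLMtoNormedSpace (𝕜 := ℝ) (σ := RingHom.id ℝ)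
    (fun w : 𝓢(ℝ × ℝ, ℝ) => toL2 (mulDxInv a w)) (fun v w => ?_) (fun c w => ?_)
    ⟨Finset.Iic (2, 0), C * ‖toL2 a‖, by positivity, fun w => ?_⟩).continuous
  · rw [mulDxInv_add_right, map_add]
  · rw [mulDxInv_smul_right, map_smul, RingHom.id_apply]
  · exact (norm_toL2_mulDxInv_le a w (hC w)).trans_eq (by ring)

/-- `f ↦ a D_x⁻¹ Re (b f̄)` as a linear map. -/
noncomputable def nonlocalₗ (a b : FieldVar) : FieldVar →ₗ[ℝ] FieldVar :=
  mulDxInvₗ a ∘ₗ reMulₗ b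

theorem nonlocalₗ_apply (a b f : FieldVar) : nonlocalₗ a b f = mulDxInv a (reMul b f) := rfl

theorem continuous_toL2_nonlocalₗ (a b : FieldVar) :
    Continuous fun f => toL2 (nonlocalₗ a b f) :=
  (continuous_toL2_mulDxInv a).comp (continuous_reMul_right b)

theorem continuous_Dx : Continuous Dx := by
  unfold Dx
  exact LineDeriv.continuous_lineDerivOp _

theorem hasDerivAt_I_smul {γ : ℝ → FieldVar} {v : FieldVar} {t : ℝ} (h : HasDerivAt γ v t) :
    HasDerivAt (fun s => Complex.I • γ s) (Complex.I • v) t := by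
  rw [hasDerivAt_iff_hasFDerivAt, hasFDerivAt_iff_isLittleOTVS] at h ⊢
  let T : FieldVar →L[ℝ] FieldVar := ⟨mulIₗ, continuous_const_smul Complex.I⟩
  refine (T.isBigOTVS_fun_comp.trans_isLittleOTVS h).congr_left fun s => ?_
  simp only [T, ContinuousLinearMap.toSpanSingleton_apply, map_sub, map_smul]
  rfl

theorem hasDerivAt_pair {γ η : ℝ → FieldVar} {v w : FieldVar} (hγ : HasDerivAt γ v 0)
    (hη : HasDerivAt η w 0) :
    HasDerivAt (fun ε => pair (γ ε) (η ε)) (pair v (η 0) + pair (γ 0) w) 0 :=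
  hasDerivAt_pair_of_clm LinearMap.id toL2.continuous hγ hη

/-- Here the curves γ, η come from arbitrary functionals, so finite-sum expansions are unavailable.
The dependence on u + εφ is an explicit quadratic polynomial in ε, whose coefficients are pairings
with fixed L²-continuous operators. -/
theorem hasDerivAt_omega_opR (u φ : FieldVar) {γ η : ℝ → FieldVar} {v w : FieldVar}
    (hγ : HasDerivAt γ v 0) (hη : HasDerivAt η w 0) :
    HasDerivAt (fun ε => omega (opR (u + ε • φ) (γ ε)) (η ε))
      (omega (opR' u φ (γ 0)) (η 0) + omega (opR u v) (η 0) + omega (opR u (γ 0)) w) 0 := by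
  have e : ∀ ε : ℝ, omega (opR (u + ε • φ) (γ ε)) (η ε) = pair (Dxₗ (γ ε)) (η ε) +
      (pair (nonlocalₗ u u (γ ε)) (η ε) + ε * (pair (nonlocalₗ φ u (γ ε)) (η ε) +
      pair (nonlocalₗ u φ (γ ε)) (η ε) + ε * pair (nonlocalₗ φ φ (γ ε)) (η ε))) := by
    intro ε
    rw [omega_opR_eq]
    simp only [reMul_add_left, mulDxInv_add_left, mulDxInv_add_right, reMul_smul_left,
      mulDxInv_smul_left, mulDxInv_smul_right, pair_add_left, pair_smul_left, nonlocalₗ_apply]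
    change _ = pair (Dx (γ ε)) (η ε) + _
    ring
  have hi := hasDerivAt_id (0 : ℝ)
  have d := fun a b => hasDerivAt_pair_of_clm (nonlocalₗ a b) (continuous_toL2_nonlocalₗ a b) hγ hη
  have h := (hasDerivAt_pair_of_clm Dxₗ (toL2.continuous.comp continuous_Dx) hγ hη).add
    ((d u u).add (hi.mul (((d φ u).add (d u φ)).add (hi.mul (d φ φ)))))
  simp only [e]
  refine h.congr_deriv ?_
  simp only [omega_opR_eq, opR', omega_I_left, pair_add_left, nonlocalₗ_apply, id, Pi.add_apply,
    Pi.mul_apply]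
  rw [show (Dxₗ v) = Dx v from rfl, show (Dxₗ (γ 0)) = Dx (γ 0) from rfl]
  ring

/-! ### Symmetry of the second variation -/

theorem hasDerivAt_pair_left_const {γ : ℝ → FieldVar} {v : FieldVar} {t : ℝ}
    (hγ : HasDerivAt γ v t) (φ : FieldVar) : HasDerivAt (fun ε => pair (γ ε) φ) (pair v φ) t := by
  have h := hasDerivAt_clm_comp toL2 hγ
  simp only [pair_eq_inner]
  simpa using (hasDerivAt_const t (toL2 φ)).inner ℝ h

theorem hasDerivAt_comp_add_of_line {V : Type*} [AddCommGroup V] [Module ℝ V] [TopologicalSpace V]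
    [ContinuousSMul ℝ V] {h : ℝ → V} {v : V} {s : ℝ}
    (hh : HasDerivAt (fun ε => h (s + ε)) v 0) : HasDerivAt h v s := by
  rw [hasDerivAt_iff_hasFDerivAt, hasFDerivAt_iff_isLittleOTVS] at hh ⊢
  have ht : Filter.Tendsto (fun x : ℝ => x - s) (nhds s) (nhds 0) :=
    (continuous_id.sub continuous_const).tendsto' s 0 (sub_self s)
  simpa [Function.comp_def] using hh.comp_tendsto ht

theorem IsVarDeriv.hasDerivAt_line {F : FieldVar → ℝ} {f : FieldVar → FieldVar}
    (h : IsVarDeriv F f) (u φ : FieldVar) (s : ℝ) :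
    HasDerivAt (fun ε : ℝ => F (u + ε • φ)) (2 * pair (f (u + s • φ)) φ) s := by
  refine hasDerivAt_comp_add_of_line ?_
  have h1 := h (u + s • φ) φ
  rw [integral_const_mul] at h1
  change HasDerivAt (fun ε : ℝ => F (u + s • φ + ε • φ)) (2 * pair (f (u + s • φ)) φ) 0 at h1
  simpa only [add_smul, add_assoc] using h1

/-- The second variation of a twice continuously differentiable functional is symmetric. -/
theorem second_variation_symm {F : FieldVar → ℝ} {f : FieldVar → FieldVar}
    {Df : FieldVar → FieldVar → FieldVar} (hF : IsVarDeriv F f)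
    (hD : ∀ u φ : FieldVar, HasDerivAt (fun ε : ℝ => f (u + ε • φ)) (Df u φ) 0)
    (hc : ∀ u φ ψ : FieldVar, Continuous fun s : ℝ × ℝ => Df (u + s.1 • φ + s.2 • ψ) φ)
    (u φ ψ : FieldVar) : pair (Df u φ) ψ = pair (Df u ψ) φ := by
  have hD' : ∀ (u φ χ : FieldVar) (s : ℝ),
      HasDerivAt (fun ε : ℝ => 2 * pair (f (u + ε • φ)) χ) (2 * pair (Df (u + s • φ) φ) χ) s := by
    intro u φ χ s
    refine hasDerivAt_comp_add_of_line ?_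
    have h1 := (hasDerivAt_pair_left_const (hD (u + s • φ) φ) χ).const_mul 2
    simpa only [add_smul, add_assoc] using h1
  have hsw : ∀ s t : ℝ, u + s • φ + t • ψ = u + t • ψ + s • φ := fun s t => add_right_comm _ _ _
  have hcφ : Continuous fun s : ℝ × ℝ => Df (u + s.1 • φ + s.2 • ψ) φ := hc u φ ψ
  have hcψ : Continuous fun s : ℝ × ℝ => Df (u + s.1 • φ + s.2 • ψ) ψ := by
    simp only [hsw]
    exact (hc u ψ φ).comp continuous_swap
  have hcp : ∀ {q : ℝ × ℝ → FieldVar} (χ : FieldVar), Continuous q →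
      Continuous fun s => 2 * pair (q s) χ := by
    intro q χ hq
    simp only [pair_eq_inner]
    exact continuous_const.mul (continuous_const.inner (toL2.continuous.comp hq))
  have h := mixed_partials_eq
    (Φ := fun s => F (u + s.1 • φ + s.2 • ψ))
    (A := fun s => 2 * pair (f (u + s.1 • φ + s.2 • ψ)) φ)
    (B := fun s => 2 * pair (f (u + s.1 • φ + s.2 • ψ)) ψ)
    (A₁ := fun s => 2 * pair (Df (u + s.1 • φ + s.2 • ψ) φ) φ)
    (A₂ := fun s => 2 * pair (Df (u + s.1 • φ + s.2 • ψ) ψ) φ)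
    (B₁ := fun s => 2 * pair (Df (u + s.1 • φ + s.2 • ψ) φ) ψ)
    (B₂ := fun s => 2 * pair (Df (u + s.1 • φ + s.2 • ψ) ψ) ψ)
    (fun s t => by simpa only [hsw] using hF.hasDerivAt_line (u + t • ψ) φ s)
    (fun s t => hF.hasDerivAt_line (u + s • φ) ψ t)
    (fun s t => by simpa only [hsw] using hD' (u + t • ψ) φ φ s)
    (fun s t => hD' (u + s • φ) ψ φ t)
    (fun s t => by simpa only [hsw] using hD' (u + t • ψ) φ ψ s)
    (fun s t => hD' (u + s • φ) ψ ψ t)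
    (hcp φ hcφ) (hcp φ hcψ) (hcp ψ hcφ) (hcp ψ hcψ) (0, 0)
  simp only [zero_smul, add_zero] at h
  linarith

/-! ### The pencil of Hamiltonian operators -/

theorem opR_opI (u f : FieldVar) : opR u (opI u f) = opH u f := by
  have h1 : imMul u f = -reMul u (opI u f) := by
    ext p
    simp [reMul_apply, imMul_apply, opI]
    ring
  ext p
  rw [opH, h1, opR_apply, opI, sub_apply, smul_apply, mulDxInv_apply, DxInv_neg, neg_smul,
    ← neg_one_smul ℝ, Dx_smul, Dx_I_smul]
  simp only [smul_apply, smul_eq_mul, Complex.real_smul]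
  push_cast
  linear_combination (-Dx f p) * Complex.I_sq

theorem I_smul_opI (u f : FieldVar) : Complex.I • opI u f = f := by
  simp [opI, smul_smul]

theorem omega_opI_right (u f g : FieldVar) : omega f (opI u g) = pair f g := by
  rw [omega, I_smul_opI]

/-- `a ℛ + b`, so that `a ℋ + b ℐ = (a ℛ + b) ℐ`. -/
noncomputable def pencil (a b : ℝ) (u f : FieldVar) : FieldVar := a • opR u f + b • f

theorem pencil_opI (a b : ℝ) (u f : FieldVar) :
    a • opH u f + b • opI u f = pencil a b u (opI u f) := by
  rw [pencil, opR_opI]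

theorem omega_smul_left (c : ℝ) (f g : FieldVar) : omega (c • f) g = c * omega f g :=
  pair_smul_left _ _ _

theorem omega_pencil (a b : ℝ) (u f g : FieldVar) :
    omega (pencil a b u f) g = a * omega (opR u f) g + b * omega f g := by
  rw [pencil, omega_add_left, omega_smul_left, omega_smul_left]

theorem omega_pencil_skew (a b : ℝ) (u f g : FieldVar) :
    omega (pencil a b u f) g = -omega (pencil a b u g) f := by
  rw [omega_pencil, omega_pencil, omega_opR, omega_swap f (opR u g), omega_swap f g]
  ring

theorem opR'_pencil (a b : ℝ) (u f g : FieldVar) :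
    opR' u (pencil a b u f) g = a • opR' u (opR u f) g + b • opR' u f g := by
  simp only [opR', pencil, mulDxInv_add_left, mulDxInv_smul_left, reMul_add_left, reMul_smul_left,
    mulDxInv_add_right, mulDxInv_smul_right]
  module

theorem omega_sub_left (f g h : FieldVar) : omega (f - g) h = omega f h - omega g h :=
  pair_sub_left _ _ _

/-- Apply closedness to (ℛf, g, h). Zero torsion for g, h, paired with f, moves the remaining ℛ into
the variation slots. -/
theorem omega_opR'_opR_cyclic (u f g h : FieldVar) :
    omega (opR' u (opR u f) g) h + omega (opR' u (opR u g) h) f +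
      omega (opR' u (opR u h) f) g = 0 := by
  have key : ∀ f g h : FieldVar, omega (opR' u (opR u f) g) h +
      (omega (opR' u (opR u g) h) f + omega (opR' u (opR u h) f) g) = 0 := by
    intro f g h
    have h1 := omega_opR'_cyclic u (opR u f) g h
    have h2 := congrArg (fun q => omega q f) (opR_hereditary u g h)
    simp only [omega_sub_left, omega_opR u (_ - _) f] at h2
    have h3 := omega_opR' u h (opR u f) g
    have h4 := omega_swap (opR u f) (opR' u h g)
    have h5 := omega_opR' u (opR u h) g f
    have h6 := omega_swap g (opR' u (opR u h) f)
    linarith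
  linarith [key f g h]

theorem isHamiltonianOperator_pencil (a b : ℝ) :
    IsHamiltonianOperator fun u f => a • opH u f + b • opI u f := by
  set 𝒟 : FieldVar → FieldVar → FieldVar := fun u f => a • opH u f + b • opI u f
  have hbr : ∀ (f g : FieldVar → FieldVar) (u : FieldVar),
      bracket 𝒟 f g u = omega (pencil a b u (opI u (f u))) (opI u (g u)) := by
    intro f g u
    rw [omega_opI_right, ← pencil_opI]
    rfl
  -- the variational derivative of a bracket
  have hvar : ∀ {F G : FieldVar → ℝ} {f g : FieldVar → FieldVar}
      {Df Dg : FieldVar → FieldVar → FieldVar}, IsVarDeriv F f → IsVarDeriv G g →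
      (∀ u φ : FieldVar, HasDerivAt (fun ε : ℝ => f (u + ε • φ)) (Df u φ) 0) →
      (∀ u φ ψ : FieldVar, Continuous fun s : ℝ × ℝ => Df (u + s.1 • φ + s.2 • ψ) φ) →
      (∀ u φ : FieldVar, HasDerivAt (fun ε : ℝ => g (u + ε • φ)) (Dg u φ) 0) →
      (∀ u φ ψ : FieldVar, Continuous fun s : ℝ × ℝ => Dg (u + s.1 • φ + s.2 • ψ) φ) →
      ∃ c : FieldVar → FieldVar, IsVarDeriv (bracket 𝒟 f g) c ∧
        ∀ u v : FieldVar, 2 * pair v (c u) =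
          a * omega (opR' u v (opI u (f u))) (opI u (g u)) +
          pair (Dg u v) (pencil a b u (opI u (f u))) -
          pair (Df u v) (pencil a b u (opI u (g u))) := by
    intro F G f g Df Dg hF hG hDf hcf hDg hcg
    -- This is the gradient of the bracket: the first line comes from varying ℛ, the other two terms
    -- from varying f and g, with `Df` and `Dg` self-adjoint as second variations. The factor 1/2
    -- offsets the 2 in `IsVarDeriv`.
    let c : FieldVar → FieldVar := fun u => (1 / 2 : ℝ) •
      (a • (mulDxInv (opI u (g u)) (reMul u (opI u (f u))) -
          mulDxInv (opI u (f u)) (reMul u (opI u (g u)))) +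
        Dg u (pencil a b u (opI u (f u))) - Df u (pencil a b u (opI u (g u))))
    have hc : ∀ u v : FieldVar, 2 * pair v (c u) =
          a * omega (opR' u v (opI u (f u))) (opI u (g u)) +
          pair (Dg u v) (pencil a b u (opI u (f u))) -
          pair (Df u v) (pencil a b u (opI u (g u))) := by
      intro u v
      simp only [c]
      rw [pair_smul_right, pair_sub_right, pair_add_right, pair_smul_right, pair_sub_right,
        omega_opR'_eq, pair_mulDxInv_swap v, pair_mulDxInv_swap v,
        second_variation_symm hF hDf hcf u v, second_variation_symm hG hDg hcg u v,
        pair_comm v, pair_comm v, pair_comm v, pair_comm v]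
      ring
    refine ⟨c, fun u φ => ?_, hc⟩
    rw [integral_const_mul]
    change HasDerivAt _ (2 * pair (c u) φ) 0
    rw [pair_comm, hc]
    have hI : ∀ {γ : ℝ → FieldVar} {v : FieldVar}, HasDerivAt γ v 0 →
        HasDerivAt (fun ε => opI u (γ ε)) (opI u v) 0 := by
      intro γ v h
      -- ℐ = -i is written as i³ in order to reuse the rule for multiplication by i.
      have h1 := hasDerivAt_I_smul (hasDerivAt_I_smul (hasDerivAt_I_smul h))
      have e : ∀ x : FieldVar, Complex.I • Complex.I • Complex.I • x = opI u x := by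
        intro x
        simp [opI, smul_smul]
      simpa only [e] using h1
    have h1 := (hasDerivAt_omega_opR u φ (hI (hDf u φ)) (hI (hDg u φ))).const_mul a
    have h2 := (hasDerivAt_pair (hI (hDf u φ)) (hDg u φ)).const_mul b
    have e : ∀ ε : ℝ, bracket 𝒟 f g (u + ε • φ) =
        a * omega (opR (u + ε • φ) (opI u (f (u + ε • φ)))) (opI u (g (u + ε • φ))) +
          b * pair (opI u (f (u + ε • φ))) (g (u + ε • φ)) := by
      intro ε
      rw [hbr, omega_pencil, omega_opI_right _ (opI _ _)]
      rfl
    simp only [e]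
    refine (h1.add h2).congr_deriv ?_
    simp only [zero_smul, add_zero]
    have i1 := omega_pencil a b u (opI u (f u)) (opI u (Dg u φ))
    have i2 := omega_pencil a b u (opI u (Df u φ)) (opI u (g u))
    have i3 := omega_pencil_skew a b u (opI u (g u)) (opI u (Df u φ))
    simp only [omega_opI_right u _ (Dg u φ)] at i1 ⊢
    rw [omega_opI_right u _ (Df u φ)] at i3
    rw [pair_comm (Dg u φ), pair_comm (Df u φ), ← omega_opI_right u (opI u (Df u φ)) (g u)]
    linear_combination i3 - i1 - i2
  intro F G K f g k ⟨hF, Df, hDf, hcf⟩ ⟨hG, Dg, hDg, hcg⟩ ⟨hK, Dk, hDk, hck⟩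
  refine ⟨fun u => by rw [hbr, hbr, omega_pencil_skew], ?_⟩
  obtain ⟨α, hα, eα⟩ := hvar hG hK hDg hcg hDk hck
  obtain ⟨β, hβ, eβ⟩ := hvar hK hF hDk hck hDf hcf
  obtain ⟨γ, hγ, eγ⟩ := hvar hF hG hDf hcf hDg hcg
  refine ⟨α, β, γ, hα, hβ, hγ, fun u => ?_⟩
  rw [hbr, hbr, hbr, omega_opI_right, omega_opI_right, omega_opI_right]
  -- Each outer bracket is the derivative of the inner one along a Hamiltonian vector field. The
  -- second-variation terms cancel through `s1`, `s2`, `s3`. `c1` removes the a² terms and `c2` the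
  -- ab terms; no b² term arises because `omega` does not depend on u.
  have e1 := eα u (pencil a b u (opI u (f u)))
  have e2 := eβ u (pencil a b u (opI u (g u)))
  have e3 := eγ u (pencil a b u (opI u (k u)))
  have s1 := second_variation_symm hF hDf hcf u (pencil a b u (opI u (g u)))
    (pencil a b u (opI u (k u)))
  have s2 := second_variation_symm hG hDg hcg u (pencil a b u (opI u (k u)))
    (pencil a b u (opI u (f u)))
  have s3 := second_variation_symm hK hDk hck u (pencil a b u (opI u (f u)))
    (pencil a b u (opI u (g u)))
  have c1 := omega_opR'_opR_cyclic u (opI u (f u)) (opI u (g u)) (opI u (k u))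
  have c2 := omega_opR'_cyclic u (opI u (f u)) (opI u (g u)) (opI u (k u))
  simp only [opR'_pencil, omega_add_left, omega_smul_left] at e1 e2 e3
  linear_combination (e1 + e2 + e3 + s1 + s2 + s3) / 2 + a * a / 2 * c1 + a * b / 2 * c2

/-! ### The first two flows -/

/-- Away from zeros of u, compare two derivatives of |u|². At a zero both sides vanish, so
differentiability of |u| is not needed there. -/
theorem absMulAbsY_eq (u : FieldVar) : absMulAbsY u = reMul u (Dy u) := by
  ext p
  have hu : HasDerivAt (fun y => u (p.1, y)) (Dy u p) p.2 := by
    have h := schwartz_hasDerivAt_line u (p.1, 0) (0, 1) p.2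
    simpa [Dy] using h
  rw [absMulAbsY, reMul_apply]
  by_cases h0 : u p = 0
  · simp [h0]
  have hn := (hu.differentiableAt.norm ℝ h0).hasDerivAt
  have h2 := hu.norm_sq.unique (hn.pow 2)
  have h3 : inner ℝ (u p) (Dy u p) = (u p * conj (Dy u p)).re := by
    rw [Complex.inner]; simp; ring
  simp only [Prod.mk.eta] at h2
  rw [h3] at h2
  norm_num at h2 ⊢
  linarith

theorem nu0_eq (u : FieldVar) : nu0 u = DxInv (reMul u (Dy u)) := by rw [nu0, absMulAbsY_eq]

theorem nu1_eq (u : FieldVar) : nu1 u = DxInv (imMul (Dx u) (Dy u)) := by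
  rw [nu1]
  congr 1; ext q
  rw [imMul_apply, mul_comm]

theorem opH_I_smul (u f : FieldVar) : opH u (Complex.I • f) = opR u f := by
  have : opI u (Complex.I • f) = f := by simp [opI, smul_smul]
  rw [← opR_opI, this]

theorem opI_I_smul (u f : FieldVar) : opI u (Complex.I • f) = f := by simp [opI, smul_smul]

theorem flow_one_apply (u : FieldVar) (p : ℝ × ℝ) :
    flow 1 u p = Complex.I * (Dx (Dy u) p + nu0 u p * u p) := by
  rw [flow_succ, opR_apply, nu0_eq, mul_comm (DxInv _ p : ℂ)]
  rfl

/-- The ν₀ term drops out, since Re(u · conj(i ν₀ u)) = 0. The exact term then integrates to a local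
one and the rest yields ν₁. -/
theorem reMul_flow_one (u : FieldVar) : reMul u (flow 1 u) =
    ∂_{((1, 0) : ℝ × ℝ)} (imMul u (Dy u)) - imMul (Dx u) (Dy u) := by
  rw [lineDeriv_imMul]
  ext p
  simp only [sub_apply, add_apply, imMul_apply, reMul_apply, flow_one_apply, Dx]
  simp
  ring

theorem flow_two_apply (u : FieldVar) (p : ℝ × ℝ) :
    -flow 2 u p = Dx (Dx (Dy u)) p + (‖u p‖ ^ 2 : ℝ) * Dy u p + nu0 u p * Dx u p +
      Complex.I * nu1 u p * u p := by
  have hD : Dx (flow 1 u) p = Complex.I * (Dx (Dx (Dy u)) p + (Dx u p * nu0 u p +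
      u p * reMul u (Dy u) p)) := by
    rw [flow_succ, opR, Dx_I_smul, Dx_add, smul_apply, add_apply, Dx_mulDxInv_apply, nu0_eq,
      smul_eq_mul]
    rfl
  have hn : ((‖u p‖ ^ 2 : ℝ) : ℂ) = u p * conj (u p) := by
    rw [Complex.mul_conj, Complex.normSq_eq_norm_sq]
  rw [flow_succ, opR_apply, hD, reMul_flow_one, DxInv_sub, DxInv_lineDeriv, ← nu1_eq, hn,
    reMul_apply, imMul_apply]
  -- The local terms combine as u (Re - i Im)(u ū_y) = |u|² u_y.
  apply Complex.ext
  · simp; ring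
  · simp; ring

theorem solves_iff {U : ℝ → FieldVar} {J : Set ℝ} {X : FieldVar → FieldVar} {c : ℂ}
    (hc : c ≠ 0) {E : FieldVar → ℝ × ℝ → ℂ} (hE : ∀ u p, c * X u p = E u p) :
    Solves X J U ↔ ∀ t ∈ J, ∀ p : ℝ × ℝ, ∃ ut : ℂ, HasDerivAt (fun τ => U τ p) ut t ∧
      c * ut = E (U t) p := by
  refine ⟨fun h t ht p => ⟨_, h t ht p, hE _ _⟩, fun h t ht p => ?_⟩
  obtain ⟨ut, h1, h2⟩ := h t ht p
  rw [← hE] at h2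
  rwa [mul_left_cancel₀ hc h2] at h1

/-! ### Involution -/

/-- Symmetry of ℛ shows that the value depends only on m + n, while `omega` is antisymmetric, so the
value equals its own negative. -/
theorem omega_flow_flow (m n : ℕ) (u : FieldVar) : omega (flow m u) (flow n u) = 0 := by
  have h : ∀ m n : ℕ, omega (flow m u) (flow n u) = omega (flow 0 u) (flow (m + n) u) := by
    intro m
    induction m with
    | zero => intro n; rw [zero_add]
    | succ m ih => intro n; rw [flow_succ, omega_opR, ← flow_succ, ih, Nat.add_right_comm]; rfl
  have h1 := omega_swap (flow m u) (flow n u)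
  rw [h m n, h n m, add_comm n m] at h1
  rw [h]
  linarith

end SurfaceFlow

/-! ### Assembly of the theorem -/

theorem mainTheorem2 :
    -- `ℋ` and `ℐ` are a compatible pair of Hamiltonian operators, and `ℛ = ℋ ℐ⁻¹`
    IsCompatibleHamiltonianPair opH opI ∧
    (∀ u : FieldVar, Function.Bijective (opI u)) ∧
    (∀ u f : FieldVar, opR u (opI u f) = opH u f) ∧
    -- the (iterated) integrals that define the Hamiltonians converge
    (∀ (n : ℕ) (u : FieldVar),
      (∀ x : ℝ, Integrable fun y : ℝ => density n u (x, y)) ∧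
      Integrable fun x : ℝ => ∫ y : ℝ, density n u (x, y)) ∧
    -- `ϖ n = δ𝔉⁽ⁿ⁾/δū`
    ∃ ϖ : ℕ → FieldVar → FieldVar,
      (∀ n : ℕ, IsFunctional (hamiltonian n) (ϖ n)) ∧
      -- bi-Hamiltonian form of the flows generated by `ℛ` from `u_y`
      (∀ u : FieldVar, opI u (ϖ 0 u) = Dy u) ∧
      (∀ n : ℕ, 1 ≤ n → ∀ u : FieldVar,
        opH u (ϖ (n - 1) u) = (opR u)^[n] (Dy u) ∧
        opI u (ϖ n u) = (opR u)^[n] (Dy u)) ∧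
      -- integrability: the Hamiltonians are in involution for both brackets, the flows commute
      (∀ (m n : ℕ) (u : FieldVar),
        bracket opH (ϖ m) (ϖ n) u = 0 ∧ bracket opI (ϖ m) (ϖ n) u = 0) ∧
      (∀ (m n : ℕ) (u : FieldVar), ∃ W : FieldVar,
        HasDerivAt (fun ε : ℝ => flow m (u + ε • flow n u)) W 0 ∧
        HasDerivAt (fun ε : ℝ => flow n (u + ε • flow m u)) W 0) ∧
      -- the nonlocal variables in the `+1` and `+2` flows
      (∀ (u : FieldVar) (p : ℝ × ℝ),
        HasDerivAt (fun x => nu0 u (x, p.2)) (absMulAbsY u p) p.1 ∧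
        HasDerivAt (fun x => nu1 u (x, p.2)) (conj (Dy u p) * Dx u p).im p.1) ∧
      -- the `+1` flow is `-i u_t = u_xy + ν₀ u`
      (∀ (J : Set ℝ) (U : ℝ → FieldVar),
        Solves (fun u => opH u (ϖ 0 u)) J U ↔
          ∀ t ∈ J, ∀ p : ℝ × ℝ, ∃ ut : ℂ, HasDerivAt (fun τ => U τ p) ut t ∧
            -Complex.I * ut = Dx (Dy (U t)) p + nu0 (U t) p * U t p) ∧
      -- the `+2` flow is `-u_t = u_xxy + |u|² u_y + ν₀ u_x + i ν₁ u`
      (∀ (J : Set ℝ) (U : ℝ → FieldVar),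
        Solves (fun u => opH u (ϖ 1 u)) J U ↔
          ∀ t ∈ J, ∀ p : ℝ × ℝ, ∃ ut : ℂ, HasDerivAt (fun τ => U τ p) ut t ∧
            -ut = Dx (Dx (Dy (U t))) p + (‖U t p‖ ^ 2 : ℝ) * Dy (U t) p
              + nu0 (U t) p * Dx (U t) p + Complex.I * nu1 (U t) p * U t p) := by
  refine ⟨isHamiltonianOperator_pencil, fun u => ?_, opR_opI,
    fun n u => ⟨integrable_density n u, integrable_integral_density n u⟩,
    fun n u => Complex.I • flow n u, isFunctional_hamiltonian, fun u => opI_I_smul u _,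
    fun n hn u => ⟨?_, opI_I_smul u _⟩, fun m n u => ⟨?_, ?_⟩,
    fun m n u => ⟨dflow m u (flow n u), hasDerivAt_flow m u _, ?_⟩, fun u p => ⟨?_, ?_⟩,
    fun J U => ?_, fun J U => ?_⟩
  · exact Function.bijective_iff_has_inverse.2 ⟨fun f => Complex.I • f, I_smul_opI u, opI_I_smul u⟩
  · obtain ⟨k, rfl⟩ := Nat.exists_eq_add_of_le' hn
    rw [Nat.add_sub_cancel, opH_I_smul, ← flow_succ]
    rfl
  · change pair (opH u (Complex.I • flow m u)) (Complex.I • flow n u) = 0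
    rw [opH_I_smul, ← flow_succ]
    exact omega_flow_flow (m + 1) n u
  · change pair (opI u (Complex.I • flow m u)) (Complex.I • flow n u) = 0
    rw [opI_I_smul]
    exact omega_flow_flow m n u
  · rw [dflow_flow_comm]
    exact hasDerivAt_flow n u _
  · rw [nu0_eq, absMulAbsY_eq]
    exact DxInv_hasDerivAt_fst _ p
  · rw [nu1_eq, mul_comm, ← imMul_apply]
    exact DxInv_hasDerivAt_fst _ p
  · refine solves_iff (c := -Complex.I) (by simp)
      (E := fun u p => Dx (Dy u) p + nu0 u p * u p) (fun u p => ?_)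
    rw [opH_I_smul, ← flow_succ, flow_one_apply, ← mul_assoc, neg_mul, Complex.I_mul_I, neg_neg,
      one_mul]
  · have h := solves_iff (U := U) (J := J)
      (X := fun u => opH u (Complex.I • flow 1 u)) (c := -1) (by simp)
      (E := fun u p => Dx (Dx (Dy u)) p + (‖u p‖ ^ 2 : ℝ) * Dy u p
        + nu0 u p * Dx u p + Complex.I * nu1 u p * u p) (fun u p => by
        rw [opH_I_smul, ← flow_succ, ← flow_two_apply, neg_one_mul])
    simpa only [neg_one_mul] using h
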